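/- **Theorem 1 (Euler–Poincaré theorem).** Let $G$ be a (finite-dimensional, real) Lie group with Lie algebra $\mathfrak g=T_eG$, whose bracket is that of left-invariant vector fields, and write $\mathrm{ad}_\xi\zeta=[\xi,\zeta]$ and $\langle \mathrm{ad}^*_\xi\mu,\zeta\rangle=\langle\mu,\mathrm{ad}_\xi\zeta\rangle$ for $\xi,\zeta\in\mathfrak g$, $\mu\in\mathfrak g^*$. Let $L(g,u_g,v_g)\in\mathbb R$ be a smooth function of $g\in G$ and of two tangent vectors $u_g,v_g\in T_gG$ that is left $G$-invariant, i.e. $L(hg,hu_g,hv_g)=L(g,u_g,v_g)$ for all $h\in G$, and let $l:\mathfrak g\times\mathfrak g\to\mathbb R$ be the reduced Lagrangian, $l(g^{-1}u_g,g^{-1}v_g)=L(g,u_g,v_g)$. Let $t_1<t_2$, $s_1<s_2$, put $R=[t_1,t_2]\times[s_1,s_2]$, let $g:\mathbb R\times\mathbb R\to G$, $(t,s)\mapsto g(t,s)$, be a smooth map, and write $\dot{\ }=\partial_t$, $'=\partial_s$, $\mathsf X=g^{-1}\dot g$, $\mathsf Y=g^{-1}g'$. Then the following four statements are equivalent. (i)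 Hamilton's variational principle $$\delta\int_{t_1}^{t_2}\!\int_{s_1}^{s_2}L(g,\dot g,g')\,ds\,dt=0$$ holds for variations $\delta g$ vanishing at the endpoints in $t$ and $s$: for every smooth family $g_\varepsilon(t,s)$, $\varepsilon\in\mathbb R$, of maps $\mathbb R\times\mathbb R\to G$ with $g_0=g$ and such that $\delta g=\partial_\varepsilon g_\varepsilon|_{\varepsilon=0}$ vanishes on the boundary of $R$, the derivative at $\varepsilon=0$ of the integral evaluated on $g_\varepsilon$ exists and is zero. (ii) On $R$, the map $g$ satisfies the Euler–Lagrange equations $$\frac{\partial L}{\partial g}-\frac{\partial}{\partial t}\frac{\partial L}{\partial g_t}-\frac{\partial}{\partial s}\frac{\partial L}{\partial g_s}=0$$ in all local coordinates on $G$. (iii) The constrained variational principle $$\delta\int_{t_1}^{t_2}\!\int_{s_1}^{s_2}l(\mathsf X,\mathsf Y)\,ds\,dt=0$$ holds for variations of the form $$\delta\mathsf X=\dot{\mathsf Z}+\mathrm{ad}_{\mathsf X}\mathsf Z,\qquad \delta\mathsf Y=\mathsf Z'+\mathrm{ad}_{\mathsf Y}\mathsf Z,$$ where $\mathsf Z:\mathbb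 R\times\mathbb R\to\mathfrak g$ is smooth and vanishes on the boundary of $R$: for every such $\mathsf Z$ and all smooth families $\mathsf X_\varepsilon,\mathsf Y_\varepsilon:\mathbb R\times\mathbb R\to\mathfrak g$, $\varepsilon\in\mathbb R$, with $\mathsf X_0=\mathsf X$, $\mathsf Y_0=\mathsf Y$ whose $\varepsilon$-derivatives at $\varepsilon=0$ are these $\delta\mathsf X,\delta\mathsf Y$, the derivative at $\varepsilon=0$ of $\int_{t_1}^{t_2}\int_{s_1}^{s_2}l(\mathsf X_\varepsilon,\mathsf Y_\varepsilon)\,ds\,dt$ exists and is zero. (iv) On $R$, the Euler–Poincaré equations hold in $\mathfrak g^*$: $$\frac{d}{dt}\frac{\delta l}{\delta\mathsf X}-\mathrm{ad}^*_{\mathsf X}\frac{\delta l}{\delta\mathsf X}+\frac{d}{ds}\frac{\delta l}{\delta\mathsf Y}-\mathrm{ad}^*_{\mathsf Y}\frac{\delta l}{\delta\mathsf Y}=0,$$ where $\frac{\delta l}{\delta\mathsf X},\frac{\delta l}{\delta\mathsf Y}\in\mathfrak g^*$ are the partial derivatives of $l$ in its first and second arguments, evaluated at $(\mathsf X(t,s),\mathsf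 Y(t,s))$. -/

import Mathlib

open Set Filter Topology Bundle
open scoped Manifold ContDiff

noncomputable section

namespace GStrand

variable {E : Type*} [NormedAddCommGroup E] [NormedSpace ℝ E]
  {H : Type*} [TopologicalSpace H] (I : ModelWithCorners ℝ E H)

/-- The Lie algebra `𝔤 = T₁G`. As a type, Mathlib's `GroupLieAlgebra I G` is the model space `E`
(see `lieAlg_eq`); this reducible name gives access to the norm of `E`, which is needed to speak
of smooth functions with values in `𝔤`. -/
abbrev LieAlg {E : Type*} [NormedAddCommGroup E] [NormedSpace ℝ E]
    {H : Type*} [TopologicalSpace H] (_I : ModelWithCorners ℝ E H)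
    (G : Type*) [TopologicalSpace G] [ChartedSpace H G] [Group G] : Type _ := E

section LieAlgebra

variable (G : Type*) [TopologicalSpace G] [ChartedSpace H G] [Group G]

theorem lieAlg_eq : LieAlg I G = GroupLieAlgebra I G := rfl

variable [FiniteDimensional ℝ E] [LieGroup I ∞ G]

/-- `ad_X : 𝔤 → 𝔤`, `ad_X Z = [X, Z]`, for the Lie bracket of left-invariant vector fields. -/
def ad (X : LieAlg I G) : LieAlg I G →L[ℝ] LieAlg I G :=
  haveI : CompleteSpace E := FiniteDimensional.complete ℝ E
  haveI : LieGroup I (minSmoothness ℝ 3) G := LieGroup.of_le (n := ∞) (by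
    rw [minSmoothness_of_isRCLikeNormedField]
    exact ENat.LEInfty.out)
  LinearMap.toContinuousLinearMap (E := E) (F' := E)
    (LieAlgebra.ad ℝ (GroupLieAlgebra I G) (X : GroupLieAlgebra I G))

theorem ad_apply (X Z : GroupLieAlgebra I G) : ad I G X Z = ⁅X, Z⁆ :=
  rfl

/-- `ad*_X : 𝔤* → 𝔤*`, the dual of `ad_X`: `⟨ad*_X μ, Z⟩ = ⟨μ, ad_X Z⟩`. -/
def adStar (X : LieAlg I G) (μ : LieAlg I G →L[ℝ] ℝ) : LieAlg I G →L[ℝ] ℝ :=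
  μ.comp (ad I G X)

end LieAlgebra

variable {G : Type*} [TopologicalSpace G] [ChartedSpace H G]

/-! ### The domain -/

/-- The closed rectangle `[t₁, t₂] × [s₁, s₂]`. -/
def rect (t₁ t₂ s₁ s₂ : ℝ) : Set (ℝ × ℝ) := Icc t₁ t₂ ×ˢ Icc s₁ s₂

/-- The endpoints in `t` and in `s`: the four sides of the rectangle. -/
def sides (t₁ t₂ s₁ s₂ : ℝ) : Set (ℝ × ℝ) :=
  {p | p ∈ rect t₁ t₂ s₁ s₂ ∧ (p.1 = t₁ ∨ p.1 = t₂ ∨ p.2 = s₁ ∨ p.2 = s₂)}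

/-! ### Lagrangians -/

/-- `L(g, u, v)`, with `u, v ∈ T_g G`, is smooth as a function on the bundle over `G` with
fibre `T_g G × T_g G`. -/
def SmoothLagrangian [IsManifold I ∞ G]
    (L : (x : G) → TangentSpace I x → TangentSpace I x → ℝ) : Prop :=
  ContMDiff (I.prod 𝓘(ℝ, E × E)) 𝓘(ℝ, ℝ) ∞
    (fun w : TotalSpace (E × E)
        ((TangentSpace I : G → Type _) ×ᵇ (TangentSpace I : G → Type _)) =>
      L w.1 w.2.1 w.2.2)

/-- Left invariance: `L(hg, hu, hv) = L(g, u, v)`, where `h` acts on tangent vectors by the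
derivative of left translation. -/
def LeftInvariant [Group G] (L : (x : G) → TangentSpace I x → TangentSpace I x → ℝ) : Prop :=
  ∀ (h x : G) (u v : TangentSpace I x),
    L (h * x) (mfderiv I I (fun y => h * y) x u) (mfderiv I I (fun y => h * y) x v) = L x u v

/-- The left trivialization `u ↦ g⁻¹ u`, from `T_g G` to `𝔤`. -/
def leftTriv [Group G] (x : G) (u : TangentSpace I x) : LieAlg I G :=
  mfderiv I I (fun y => x⁻¹ * y) x u

/-- The reduced Lagrangian `l : 𝔤 × 𝔤 → ℝ`, the restriction of `L` to the identity. -/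
def reduced [Group G] (L : (x : G) → TangentSpace I x → TangentSpace I x → ℝ)
    (ξ η : LieAlg I G) : ℝ :=
  L 1 ξ η

/-- The reduced Lagrangian satisfies, and is determined by, `l(g⁻¹u, g⁻¹v) = L(g, u, v)`. -/
theorem reduced_leftTriv [Group G]
    {L : (x : G) → TangentSpace I x → TangentSpace I x → ℝ} (hL : LeftInvariant I L)
    (x : G) (u v : TangentSpace I x) :
    reduced I L (leftTriv I x u) (leftTriv I x v) = L x u v := by
  have key : ∀ (y : G) (_ : y = 1) (a b : E),
      L y (a : TangentSpace I y) (b : TangentSpace I y) = L 1 a b := by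
    rintro y rfl a b
    rfl
  rw [← hL x⁻¹ x u v]
  exact (key _ (inv_mul_cancel x) _ _).symm

/-! ### Maps `g(t, s)` into `G` -/

/-- `g_t(t, s) ∈ T_{g(t,s)} G`. -/
def velT (g : ℝ × ℝ → G) (p : ℝ × ℝ) : TangentSpace I (g p) :=
  mfderiv 𝓘(ℝ, ℝ) I (fun τ : ℝ => g (τ, p.2)) p.1 (1 : ℝ)

/-- `g_s(t, s) ∈ T_{g(t,s)} G`. -/
def velS (g : ℝ × ℝ → G) (p : ℝ × ℝ) : TangentSpace I (g p) :=
  mfderiv 𝓘(ℝ, ℝ) I (fun σ : ℝ => g (p.1, σ)) p.2 (1 : ℝ)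

/-- `X = g⁻¹ g_t`. -/
def fieldX [Group G] (g : ℝ × ℝ → G) (p : ℝ × ℝ) : LieAlg I G := leftTriv I (g p) (velT I g p)

/-- `Y = g⁻¹ g_s`. -/
def fieldY [Group G] (g : ℝ × ℝ → G) (p : ℝ × ℝ) : LieAlg I G := leftTriv I (g p) (velS I g p)

/-- The partial derivative in `t` of a map into a normed space. -/
def dT {F : Type*} [NormedAddCommGroup F] [NormedSpace ℝ F] (f : ℝ × ℝ → F) (p : ℝ × ℝ) : F :=
  deriv (fun τ : ℝ => f (τ, p.2)) p.1

/-- The partial derivative in `s` of a map into a normed space. -/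
def dS {F : Type*} [NormedAddCommGroup F] [NormedSpace ℝ F] (f : ℝ × ℝ → F) (p : ℝ × ℝ) : F :=
  deriv (fun σ : ℝ => f (p.1, σ)) p.2

/-! ### Hamilton's principle -/

/-- The action `∫∫ L(g, g_t, g_s) ds dt` over the rectangle. -/
def action (L : (x : G) → TangentSpace I x → TangentSpace I x → ℝ) (t₁ t₂ s₁ s₂ : ℝ)
    (g : ℝ × ℝ → G) : ℝ :=
  ∫ t in t₁..t₂, ∫ s in s₁..s₂, L (g (t, s)) (velT I g (t, s)) (velS I g (t, s))

/-- `Γ(ε, (t, s))` is a smooth deformation of `g` whose variation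
`δg = ∂Γ/∂ε` at `ε = 0` vanishes on the sides of the rectangle. -/
structure IsDeformation (t₁ t₂ s₁ s₂ : ℝ) (g : ℝ × ℝ → G) (Γ : ℝ × (ℝ × ℝ) → G) : Prop where
  smooth : ContMDiff 𝓘(ℝ, ℝ × (ℝ × ℝ)) I ∞ Γ
  base : ∀ p, Γ (0, p) = g p
  fixed : ∀ p ∈ sides t₁ t₂ s₁ s₂,
    mfderiv 𝓘(ℝ, ℝ) I (fun ε : ℝ => Γ (ε, p)) 0 (1 : ℝ) = 0

/-- Hamilton's principle `δ ∫∫ L(g, g_t, g_s) ds dt = 0`. -/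
def HamiltonPrinciple (L : (x : G) → TangentSpace I x → TangentSpace I x → ℝ)
    (t₁ t₂ s₁ s₂ : ℝ) (g : ℝ × ℝ → G) : Prop :=
  ∀ Γ : ℝ × (ℝ × ℝ) → G, IsDeformation I t₁ t₂ s₁ s₂ g Γ →
    HasDerivAt (fun ε : ℝ => action I L t₁ t₂ s₁ s₂ (fun p => Γ (ε, p))) 0 0

/-! ### The Euler–Lagrange equations -/

/-- The Lagrangian in the local coordinates given by a chart `φ` of `G`. -/
def coordLagrangian (L : (x : G) → TangentSpace I x → TangentSpace I x → ℝ)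
    (φ : OpenPartialHomeomorph G H) (q u v : E) : ℝ :=
  L ((φ.extend I).symm q) (mfderiv 𝓘(ℝ, E) I (φ.extend I).symm q u)
    (mfderiv 𝓘(ℝ, E) I (φ.extend I).symm q v)

/-- The left-hand side `∂L/∂q - ∂/∂t ∂L/∂q_t - ∂/∂s ∂L/∂q_s ∈ E*` of the Euler–Lagrange equations
for a map `q` with values in an open subset of the coordinate space `E`. -/
def eulerLagrangeExpr (Λ : E → E → E → ℝ) (q : ℝ × ℝ → E) (p : ℝ × ℝ) : E →L[ℝ] ℝ :=
  fderiv ℝ (fun x => Λ x (dT q p) (dS q p)) (q p)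
    - dT (fun r => fderiv ℝ (fun u => Λ (q r) u (dS q r)) (dT q r)) p
    - dS (fun r => fderiv ℝ (fun v => Λ (q r) (dT q r) v) (dS q r)) p

/-- `g` satisfies the Euler–Lagrange equations on the rectangle, in all charts of `G`. -/
def EulerLagrange (L : (x : G) → TangentSpace I x → TangentSpace I x → ℝ)
    (t₁ t₂ s₁ s₂ : ℝ) (g : ℝ × ℝ → G) : Prop :=
  ∀ φ ∈ IsManifold.maximalAtlas I ∞ G, ∀ p ∈ rect t₁ t₂ s₁ s₂, g p ∈ φ.source →
    eulerLagrangeExpr (coordLagrangian I L φ) (fun r => φ.extend I (g r)) p = 0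

section Reduced

variable (G) [Group G] [FiniteDimensional ℝ E] [LieGroup I ∞ G]

/-! ### The reduced principle and the Euler–Poincaré equations -/

/-- The constrained principle `δ ∫∫ l(X, Y) ds dt = 0`, for all smooth deformations
`(ξ(ε, ·), η(ε, ·))` of `(X, Y)` with `δX = Z_t + ad_X Z` and `δY = Z_s + ad_Y Z`, where `Z` is a
smooth map into `𝔤` that vanishes on the sides of the rectangle. -/
def ConstrainedPrinciple (l : LieAlg I G → LieAlg I G → ℝ) (t₁ t₂ s₁ s₂ : ℝ)
    (X Y : ℝ × ℝ → LieAlg I G) : Prop :=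
  ∀ (Z : ℝ × ℝ → LieAlg I G) (ξ η : ℝ × (ℝ × ℝ) → LieAlg I G),
    ContDiff ℝ ∞ Z → (∀ p ∈ sides t₁ t₂ s₁ s₂, Z p = 0) →
    ContDiff ℝ ∞ ξ → ContDiff ℝ ∞ η →
    (∀ p, ξ (0, p) = X p) → (∀ p, η (0, p) = Y p) →
    (∀ p, deriv (fun ε : ℝ => ξ (ε, p)) 0 = dT Z p + ad I G (X p) (Z p)) →
    (∀ p, deriv (fun ε : ℝ => η (ε, p)) 0 = dS Z p + ad I G (Y p) (Z p)) →
    HasDerivAt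
      (fun ε : ℝ => ∫ t in t₁..t₂, ∫ s in s₁..s₂, l (ξ (ε, (t, s))) (η (ε, (t, s)))) 0 0

/-- `δl/δX` at `(ξ, η)`, an element of `𝔤*`. -/
def dlX (l : LieAlg I G → LieAlg I G → ℝ) (ξ η : LieAlg I G) : LieAlg I G →L[ℝ] ℝ :=
  fderiv ℝ (fun x => l x η) ξ

/-- `δl/δY` at `(ξ, η)`, an element of `𝔤*`. -/
def dlY (l : LieAlg I G → LieAlg I G → ℝ) (ξ η : LieAlg I G) : LieAlg I G →L[ℝ] ℝ :=
  fderiv ℝ (fun y => l ξ y) η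

/-- The Euler–Poincaré equations
`d/dt δl/δX - ad*_X δl/δX + d/ds δl/δY - ad*_Y δl/δY = 0` in `𝔤*`, on the rectangle. -/
def EulerPoincare (l : LieAlg I G → LieAlg I G → ℝ) (t₁ t₂ s₁ s₂ : ℝ)
    (X Y : ℝ × ℝ → LieAlg I G) : Prop :=
  ∀ p ∈ rect t₁ t₂ s₁ s₂,
    dT (fun r => dlX I G l (X r) (Y r)) p - adStar I G (X p) (dlX I G l (X p) (Y p))
      + dS (fun r => dlY I G l (X r) (Y r)) p - adStar I G (Y p) (dlY I G l (X p) (Y p)) = 0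

end Reduced

end GStrand

end

noncomputable section

namespace GStrand

section MaurerCartan

variable {E : Type*} [NormedAddCommGroup E] [NormedSpace ℝ E]
  {H : Type*} [TopologicalSpace H] (I : ModelWithCorners ℝ E H)
  {G : Type*} [TopologicalSpace G] [ChartedSpace H G] [Group G]
  {N N' : Type*} [NormedAddCommGroup N] [NormedSpace ℝ N]
  [NormedAddCommGroup N'] [NormedSpace ℝ N']

/-- The pullback of the left Maurer–Cartan form by a map `f : N → G`, that is, `f⁻¹ df`. -/
def mcForm (f : N → G) (p : N) : N →L[ℝ] E :=
  fderiv ℝ (fun r => extChartAt I (1 : G) ((f p)⁻¹ * f r)) p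

variable {I}

theorem differentiableAt_chart_mul [LieGroup I ∞ G] {f : N → G} {p : N}
    (hf : MDifferentiableAt 𝓘(ℝ, N) I f p) :
    DifferentiableAt ℝ (fun r => extChartAt I (1 : G) ((f p)⁻¹ * f r)) p := by
  rw [← mdifferentiableAt_iff_differentiableAt]
  have h0 : MDifferentiableAt I I (fun y : G => (f p)⁻¹ * y) (f p) :=
    (contMDiff_mul_left (I := I) (n := ∞)).mdifferentiableAt (by simp)
  have h1 : MDifferentiableAt 𝓘(ℝ, N) I (fun r => (f p)⁻¹ * f r) p := h0.comp p hf
  have h2 : MDifferentiableAt I 𝓘(ℝ, E) (extChartAt I (1 : G)) ((f p)⁻¹ * f p) := by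
    rw [inv_mul_cancel]; exact mdifferentiableAt_extChartAt (mem_chart_source H 1)
  exact h2.comp p h1

theorem mcForm_apply [LieGroup I ∞ G] {f : N → G} {p : N}
    (hf : MDifferentiableAt 𝓘(ℝ, N) I f p) (v : N) :
    mcForm I f p v = leftTriv I (f p) (mfderiv 𝓘(ℝ, N) I f p v) := by
  have h0 : MDifferentiableAt I I (fun y : G => (f p)⁻¹ * y) (f p) :=
    (contMDiff_mul_left (I := I) (n := ∞)).mdifferentiableAt (by simp)
  have h1 : MDifferentiableAt 𝓘(ℝ, N) I (fun r => (f p)⁻¹ * f r) p := h0.comp p hf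
  have h2 := mfderiv_comp p h0 hf
  have h3 : leftTriv I (f p) (mfderiv 𝓘(ℝ, N) I f p v) =
      mfderiv 𝓘(ℝ, N) I (fun r => (f p)⁻¹ * f r) p v := by
    change _ = mfderiv 𝓘(ℝ, N) I ((fun y : G => (f p)⁻¹ * y) ∘ f) p v
    rw [h2]; rfl
  have h4 := congrArg (fun T : N →L[ℝ] E => T v) h1.mfderiv
  rw [h3]
  refine Eq.trans ?_ h4.symm
  simp [mcForm, writtenInExtChartAt, Function.comp_def, chartAt_self_eq]

theorem mcForm_comp [LieGroup I ∞ G] {f : N → G} {h : N' → N} {p : N'}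
    (hf : MDifferentiableAt 𝓘(ℝ, N) I f (h p)) (hh : DifferentiableAt ℝ h p) :
    mcForm I (fun r => f (h r)) p = (mcForm I f (h p)).comp (fderiv ℝ h p) :=
  fderiv_comp p (differentiableAt_chart_mul hf) hh

theorem mcForm_congr {f f' : N → G} {p : N} (h : f =ᶠ[𝓝 p] f') :
    mcForm I f p = mcForm I f' p := by
  unfold mcForm
  rw [h.eq_of_nhds]
  apply Filter.EventuallyEq.fderiv_eq
  filter_upwards [h] with r hr
  rw [hr]

theorem contDiffAt_mcForm [LieGroup I ∞ G] {f : N → G} {p : N}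
    (hf : ContMDiffAt 𝓘(ℝ, N) I ∞ f p) : ContDiffAt ℝ ∞ (mcForm I f) p := by
  have key : ContDiffAt ℝ ∞
      (Function.uncurry (fun (p r : N) => extChartAt I (1 : G) ((f p)⁻¹ * f r))) (p, id p) := by
    rw [← contMDiffAt_iff_contDiffAt]
    have e1 : ContMDiffAt 𝓘(ℝ, N × N) I ∞ (fun z : N × N => f z.1) (p, p) :=
      ContMDiffAt.comp (p, p) (g := f) (f := Prod.fst) hf contDiffAt_fst.contMDiffAt
    have e2 : ContMDiffAt 𝓘(ℝ, N × N) I ∞ (fun z : N × N => f z.2) (p, p) :=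
      ContMDiffAt.comp (p, p) (g := f) (f := Prod.snd) hf contDiffAt_snd.contMDiffAt
    have h1 : ContMDiffAt 𝓘(ℝ, N × N) I ∞ (fun z : N × N => (f z.1)⁻¹ * f z.2) (p, p) :=
      e1.inv.mul e2
    have h2 : ContMDiffAt I 𝓘(ℝ, E) ∞ (extChartAt I (1 : G)) ((f p)⁻¹ * f p) := by
      rw [inv_mul_cancel]; exact contMDiffAt_extChartAt
    exact ContMDiffAt.comp (p, p) (g := extChartAt I (1 : G))
      (f := fun z : N × N => (f z.1)⁻¹ * f z.2) h2 h1
  exact key.fderiv contDiffAt_id le_rfl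

theorem contDiff_mcForm [LieGroup I ∞ G] {f : N → G} (hf : ContMDiff 𝓘(ℝ, N) I ∞ f) :
    ContDiff ℝ ∞ (mcForm I f) :=
  contDiff_iff_contDiffAt.2 fun p => contDiffAt_mcForm (hf p)

/-! ### Local coordinates -/

theorem contMDiffAt_chart_symm [I.Boundaryless] [LieGroup I ∞ G] {φ : OpenPartialHomeomorph G H}
    (hφ : φ ∈ IsManifold.maximalAtlas I ∞ G) {q : E} (hq : q ∈ (φ.extend I).target) :
    ContMDiffAt 𝓘(ℝ, E) I ∞ (φ.extend I).symm q := by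
  have := contMDiffOn_extend_symm hφ
  rw [← φ.extend_target'] at this
  exact this.contMDiffAt (φ.isOpen_extend_target.mem_nhds hq)

theorem isInvertible_of_injective [FiniteDimensional ℝ E] {A : E →L[ℝ] E}
    (hA : Function.Injective A) : A.IsInvertible :=
  ⟨(LinearEquiv.ofInjectiveEndo A.toLinearMap hA).toContinuousLinearEquiv, by ext; rfl⟩

theorem leftTriv_mulInvariantVectorField [LieGroup I ∞ G] (ξ : GroupLieAlgebra I G) (x : G) :
    leftTriv I x (mulInvariantVectorField ξ x) = ξ := by
  have M : ∀ y z : G, MDifferentiableAt I I (fun b => y * b) z := fun y z =>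
    (contMDiff_mul_left (I := I) (n := ∞)).mdifferentiableAt (by simp)
  have h := mfderiv_comp (1 : G) (M x⁻¹ (x * 1)) (M x 1)
  have h2 : ((fun y => x⁻¹ * y) ∘ fun b => x * b) = (id : G → G) := by ext; simp
  rw [h2, mfderiv_id] at h
  have key : ∀ (y : G) (_ : y = x) (w : E),
      (mfderiv I I (fun b => x⁻¹ * b) y w : E) = mfderiv I I (fun b => x⁻¹ * b) x w := by
    rintro y rfl w; rfl
  have h3 := congrArg (fun T => (T ξ : E)) h
  exact (key (x * 1) (mul_one x) _).symm.trans h3.symm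

theorem mulInvariantVectorField_leftTriv [LieGroup I ∞ G] (x : G) (u : TangentSpace I x) :
    mulInvariantVectorField (I := I) (G := G) (leftTriv I x u) x = u := by
  have M : ∀ y z : G, MDifferentiableAt I I (fun b => y * b) z := fun y z =>
    (contMDiff_mul_left (I := I) (n := ∞)).mdifferentiableAt (by simp)
  have h := mfderiv_comp x (M x (x⁻¹ * x)) (M x⁻¹ x)
  have h2 : ((fun b => x * b) ∘ fun y => x⁻¹ * y) = (id : G → G) := by ext; simp
  rw [h2, mfderiv_id] at h
  have key : ∀ (y : G) (_ : y = 1) (w : E),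
      (mfderiv I I (fun b => x * b) y w : E) = mfderiv I I (fun b => x * b) 1 w := by
    rintro y rfl w; rfl
  have h3 := congrArg (fun T => (T u : E)) h
  exact (key (x⁻¹ * x) (inv_mul_cancel x) _).symm.trans h3.symm

theorem mfderiv_chart_symm_injective [I.Boundaryless] [LieGroup I ∞ G]
    {φ : OpenPartialHomeomorph G H}
    (hφ : φ ∈ IsManifold.maximalAtlas I ∞ G) {q : E} (hq : q ∈ (φ.extend I).target) :
    Function.Injective (mfderiv 𝓘(ℝ, E) I (φ.extend I).symm q) := by
  have h1 : MDifferentiableAt 𝓘(ℝ, E) I (φ.extend I).symm q :=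
    (contMDiffAt_chart_symm hφ hq).mdifferentiableAt (by simp)
  have h2 : MDifferentiableAt I 𝓘(ℝ, E) (φ.extend I) ((φ.extend I).symm q) := by
    refine (φ.contMDiffAt_extend hφ ?_).mdifferentiableAt (by simp)
    have := (φ.extend I).map_target hq
    rwa [φ.extend_source] at this
  have h := mfderiv_comp q h2 h1
  have h3 : (φ.extend I ∘ (φ.extend I).symm) =ᶠ[𝓝 q] id := by
    filter_upwards [φ.isOpen_extend_target.mem_nhds hq] with r hr
    exact (φ.extend I).right_inv hr
  rw [h3.mfderiv_eq, mfderiv_id] at h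
  intro a b hab
  have ha := congrArg (fun T => (T a : E)) h
  have hb := congrArg (fun T => (T b : E)) h
  refine ha.trans (Eq.trans ?_ hb.symm)
  exact congrArg (mfderiv I 𝓘(ℝ, E) (φ.extend I) ((φ.extend I).symm q)) hab

theorem mcForm_chart_symm_injective [I.Boundaryless] [LieGroup I ∞ G]
    {φ : OpenPartialHomeomorph G H}
    (hφ : φ ∈ IsManifold.maximalAtlas I ∞ G) {q : E} (hq : q ∈ (φ.extend I).target) :
    Function.Injective (mcForm I (φ.extend I).symm q) := by
  have h1 : MDifferentiableAt 𝓘(ℝ, E) I (φ.extend I).symm q :=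
    (contMDiffAt_chart_symm hφ hq).mdifferentiableAt (by simp)
  intro a b hab
  rw [mcForm_apply h1, mcForm_apply h1] at hab
  apply mfderiv_chart_symm_injective hφ hq
  have := congrArg (fun ξ => mulInvariantVectorField (I := I) (G := G) ξ ((φ.extend I).symm q)) hab
  simpa only [mulInvariantVectorField_leftTriv] using this

end MaurerCartan

section LocalCoordinates

variable {E : Type*} [NormedAddCommGroup E] [NormedSpace ℝ E]
  {H : Type*} [TopologicalSpace H] {I : ModelWithCorners ℝ E H}
  {G : Type*} [TopologicalSpace G] [ChartedSpace H G]
  {N : Type*} [NormedAddCommGroup N] [NormedSpace ℝ N]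

theorem contDiffAt_extend_comp {φ : OpenPartialHomeomorph G H}
    (hφ : φ ∈ IsManifold.maximalAtlas I ∞ G) {f : N → G} {p : N}
    (hf : ContMDiffAt 𝓘(ℝ, N) I ∞ f p) (hs : f p ∈ φ.source) :
    ContDiffAt ℝ ∞ (fun r => φ.extend I (f r)) p := by
  rw [← contMDiffAt_iff_contDiffAt]
  exact (φ.contMDiffAt_extend hφ hs).comp p hf

theorem eventually_differentiableAt_extend_comp {φ : OpenPartialHomeomorph G H}
    (hφ : φ ∈ IsManifold.maximalAtlas I ∞ G) {f : N → G} {p : N}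
    (hf : ContMDiffAt 𝓘(ℝ, N) I ∞ f p) (hs : f p ∈ φ.source) :
    ∀ᶠ r in 𝓝 p, DifferentiableAt ℝ (fun r => φ.extend I (f r)) r := by
  filter_upwards [((contDiffAt_extend_comp hφ hf hs).of_le (m := 1) (by simp)).eventually
    (by simp)] with r hr
  exact hr.differentiableAt (by simp)

theorem eventually_mem_source {φ : OpenPartialHomeomorph G H} {f : N → G} {p : N}
    (hf : ContMDiffAt 𝓘(ℝ, N) I ∞ f p) (hs : f p ∈ φ.source) : ∀ᶠ r in 𝓝 p, f r ∈ φ.source :=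
  hf.continuousAt.eventually_mem (φ.open_source.mem_nhds hs)

variable [I.Boundaryless] [Group G] [LieGroup I ∞ G]

theorem mcForm_eventuallyEq_chart {φ : OpenPartialHomeomorph G H}
    (hφ : φ ∈ IsManifold.maximalAtlas I ∞ G) {f : N → G} {p : N}
    (hf : ContMDiffAt 𝓘(ℝ, N) I ∞ f p) (hs : f p ∈ φ.source) :
    mcForm I f =ᶠ[𝓝 p] fun r => (mcForm I (φ.extend I).symm (φ.extend I (f r))).comp
      (fderiv ℝ (fun r => φ.extend I (f r)) r) := by
  have hev := eventually_mem_source hf hs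
  filter_upwards [eventually_differentiableAt_extend_comp hφ hf hs, hev, hev.eventually_nhds]
    with r hr1 hr2 hr3
  have hr2' : f r ∈ (φ.extend I).source := by rwa [φ.extend_source]
  rw [← mcForm_comp (f := (φ.extend I).symm) (h := fun r => φ.extend I (f r))
    ((contMDiffAt_chart_symm hφ ((φ.extend I).map_source hr2')).mdifferentiableAt (by simp)) hr1]
  apply mcForm_congr
  filter_upwards [hr3] with r' hr'
  exact ((φ.extend I).left_inv (by rwa [φ.extend_source])).symm

end LocalCoordinates

section StructureEquation

open VectorField

variable {E : Type*} [NormedAddCommGroup E] [NormedSpace ℝ E] [FiniteDimensional ℝ E]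
  {H : Type*} [TopologicalSpace H] {I : ModelWithCorners ℝ E H} [I.Boundaryless]
  {G : Type*} [TopologicalSpace G] [ChartedSpace H G] [Group G] [LieGroup I ∞ G]
  {N : Type*} [NormedAddCommGroup N] [NormedSpace ℝ N]

theorem mcForm_chart_symm_isInvertible {φ : OpenPartialHomeomorph G H}
    (hφ : φ ∈ IsManifold.maximalAtlas I ∞ G) {q : E} (hq : q ∈ (φ.extend I).target) :
    (mcForm I (φ.extend I).symm q).IsInvertible :=
  isInvertible_of_injective (mcForm_chart_symm_injective hφ hq)

theorem mpullback_mulInvariantVectorField_chart {φ : OpenPartialHomeomorph G H}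
    (hφ : φ ∈ IsManifold.maximalAtlas I ∞ G) {q : E} (hq : q ∈ (φ.extend I).target)
    (ξ : GroupLieAlgebra I G) :
    mpullback 𝓘(ℝ, E) I (φ.extend I).symm (mulInvariantVectorField ξ) q =
      (mcForm I (φ.extend I).symm q).inverse ξ := by
  have h1 : MDifferentiableAt 𝓘(ℝ, E) I (φ.extend I).symm q :=
    (contMDiffAt_chart_symm hφ hq).mdifferentiableAt (by simp)
  apply mcForm_chart_symm_injective hφ hq
  let D : E →L[ℝ] E := mfderiv 𝓘(ℝ, E) I (φ.extend I).symm q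
  have hinv : D.IsInvertible :=
    isInvertible_of_injective (mfderiv_chart_symm_injective hφ hq)
  refine Eq.trans ?_ ((mcForm_chart_symm_isInvertible hφ hq).self_apply_inverse ξ).symm
  refine (mcForm_apply h1 _).trans ?_
  have h2 := hinv.self_apply_inverse (mulInvariantVectorField ξ ((φ.extend I).symm q))
  exact (congrArg (leftTriv I _) h2).trans (leftTriv_mulInvariantVectorField ξ _)

theorem lieBracket_inverse_mcForm {φ : OpenPartialHomeomorph G H}
    (hφ : φ ∈ IsManifold.maximalAtlas I ∞ G) {q : E} (hq : q ∈ (φ.extend I).target)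
    (ξ η : GroupLieAlgebra I G) :
    lieBracket ℝ (fun r => (mcForm I (φ.extend I).symm r).inverse ξ)
      (fun r => (mcForm I (φ.extend I).symm r).inverse η) q =
      (mcForm I (φ.extend I).symm q).inverse (ad I G ξ η) := by
  have : CompleteSpace E := FiniteDimensional.complete ℝ E
  have h3 : minSmoothness ℝ 3 ≤ ∞ := by
    rw [minSmoothness_of_isRCLikeNormedField]; exact ENat.LEInfty.out
  have : LieGroup I (minSmoothness ℝ 3) G := LieGroup.of_le (n := ∞) h3
  have hV : ∀ ξ : GroupLieAlgebra I G,
      mpullback 𝓘(ℝ, E) I (φ.extend I).symm (mulInvariantVectorField ξ) =ᶠ[𝓝 q]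
        fun r => (mcForm I (φ.extend I).symm r).inverse ξ := fun ξ => by
    filter_upwards [φ.isOpen_extend_target.mem_nhds hq] with r hr
    exact mpullback_mulInvariantVectorField_chart hφ hr ξ
  have h := mpullback_mlieBracket (x₀ := q) (n := minSmoothness ℝ 3)
    (mdifferentiableAt_mulInvariantVectorField (I := I) (G := G) ξ)
    (mdifferentiableAt_mulInvariantVectorField (I := I) (G := G) η)
    ((contMDiffAt_chart_symm hφ hq).of_le h3) (minSmoothness_monotone (by norm_cast))
  rw [← mulInvariantVector_mlieBracket, mpullback_mulInvariantVectorField_chart hφ hq] at h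
  have e : ∀ V W : E → E, mlieBracket 𝓘(ℝ, E) V W q = lieBracket ℝ V W q := fun V W =>
    (congrFun (mlieBracketWithin_eq_lieBracketWithin (V := V) (W := W) (s := univ)) q).trans
      (congrFun lieBracketWithin_univ q)
  refine Eq.trans ?_ (h.trans (e _ _)).symm
  exact ((hV ξ).symm.lieBracket_vectorField_eq (hV η).symm)

theorem mcForm_chart_structure {φ : OpenPartialHomeomorph G H}
    (hφ : φ ∈ IsManifold.maximalAtlas I ∞ G) {q : E} (hq : q ∈ (φ.extend I).target) (u w : E) :
    fderiv ℝ (mcForm I (φ.extend I).symm) q w u - fderiv ℝ (mcForm I (φ.extend I).symm) q u w =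
      ad I G (mcForm I (φ.extend I).symm q u) (mcForm I (φ.extend I).symm q w) := by
  have : CompleteSpace E := FiniteDimensional.complete ℝ E
  set A := mcForm I (φ.extend I).symm with hA
  have hinv : (A q).IsInvertible := mcForm_chart_symm_isInvertible hφ hq
  have dA : DifferentiableAt ℝ A q :=
    (contDiffAt_mcForm (contMDiffAt_chart_symm hφ hq)).differentiableAt (by simp)
  have dB : ∀ ξ : E, DifferentiableAt ℝ (fun r => (A r).inverse ξ) q := fun ξ =>
    (((hinv.contDiffAt_map_inverse (n := 1)).differentiableAt (by simp)).comp q dA).clm_apply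
      (differentiableAt_const ξ)
  have hBA : ∀ u : E, (A q).inverse (A q u) = u := fun u => hinv.inverse_apply_self u
  have key : ∀ u w : E, A q (fderiv ℝ (fun r => (A r).inverse (A q u)) q w) =
      - fderiv ℝ A q w u := by
    intro u w
    have h1 : (fun r => A r ((A r).inverse (A q u))) =ᶠ[𝓝 q] fun _ => A q u := by
      filter_upwards [φ.isOpen_extend_target.mem_nhds hq] with r hr
      exact (mcForm_chart_symm_isInvertible hφ hr).self_apply_inverse _
    have h2 := h1.fderiv_eq (𝕜 := ℝ)
    rw [fderiv_clm_apply dA (dB _)] at h2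
    have h3 := congrArg (fun T : E →L[ℝ] E => T w) h2
    simp [hBA] at h3
    exact eq_neg_of_add_eq_zero_left h3
  have hb := lieBracket_inverse_mcForm hφ hq (A q u) (A q w)
  have hb2 := congrArg (A q) hb
  rw [← hA, lieBracket, hinv.self_apply_inverse] at hb2
  simp only [hBA, map_sub, key] at hb2
  rw [← hb2]
  abel

/-- The Maurer–Cartan structure equation. -/
theorem mcForm_structure {f : N → G} {p : N} (hf : ContMDiffAt 𝓘(ℝ, N) I ∞ f p) (a b : N) :
    fderiv ℝ (mcForm I f) p a b - fderiv ℝ (mcForm I f) p b a =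
      ad I G (mcForm I f p b) (mcForm I f p a) := by
  set φ := chartAt H (f p)
  have hφ : φ ∈ IsManifold.maximalAtlas I ∞ G := IsManifold.chart_mem_maximalAtlas _
  have hs : f p ∈ φ.source := mem_chart_source H (f p)
  have hs' : f p ∈ (φ.extend I).source := by rwa [φ.extend_source]
  set ψ := (φ.extend I).symm
  set q : N → E := fun r => φ.extend I (f r)
  have hqt : q p ∈ (φ.extend I).target := (φ.extend I).map_source hs'
  have sq : ContDiffAt ℝ ∞ q p := contDiffAt_extend_comp hφ hf hs
  have dq : DifferentiableAt ℝ q p := sq.differentiableAt (by simp)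
  have hloc : mcForm I f =ᶠ[𝓝 p] fun r => (mcForm I ψ (q r)).comp (fderiv ℝ q r) :=
    mcForm_eventuallyEq_chart hφ hf hs
  have dA : DifferentiableAt ℝ (mcForm I ψ) (q p) :=
    (contDiffAt_mcForm (contMDiffAt_chart_symm hφ hqt)).differentiableAt (by simp)
  have ddq : DifferentiableAt ℝ (fderiv ℝ q) p :=
    (sq.fderiv_right (m := 1) (by
      rw [one_add_one_eq_two]; exact ENat.LEInfty.out)).differentiableAt (by simp)
  have hD : ∀ a b : N, fderiv ℝ (mcForm I f) p a b =
      mcForm I ψ (q p) (fderiv ℝ (fderiv ℝ q) p a b) +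
        fderiv ℝ (mcForm I ψ) (q p) (fderiv ℝ q p a) (fderiv ℝ q p b) := by
    intro a b
    have hc : HasFDerivAt (fun r => mcForm I ψ (q r))
        ((fderiv ℝ (mcForm I ψ) (q p)).comp (fderiv ℝ q p)) p :=
      dA.hasFDerivAt.comp p dq.hasFDerivAt
    rw [hloc.fderiv_eq, (hc.clm_comp ddq.hasFDerivAt).fderiv]
    simp
  have hsymm : fderiv ℝ (fderiv ℝ q) p a b = fderiv ℝ (fderiv ℝ q) p b a :=
    (sq.isSymmSndFDerivAt (by
      rw [minSmoothness_of_isRCLikeNormedField]; exact ENat.LEInfty.out)).eq a b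
  have hbp : ∀ v, mcForm I f p v = mcForm I ψ (q p) (fderiv ℝ q p v) := fun v => by
    rw [hloc.eq_of_nhds]; rfl
  rw [hD, hD, hsymm, add_sub_add_left_eq_sub, hbp, hbp]
  exact mcForm_chart_structure hφ hqt _ _

end StructureEquation

section Lagrangian

variable {E : Type*} [NormedAddCommGroup E] [NormedSpace ℝ E]
  {H : Type*} [TopologicalSpace H] {I : ModelWithCorners ℝ E H}
  {G : Type*} [TopologicalSpace G] [ChartedSpace H G] [Group G] [LieGroup I ∞ G]

theorem trivializationAt_one_apply (u : E) :
    (trivializationAt E (TangentSpace I : G → Type _) 1 ⟨1, u⟩).2 = u :=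
  (tangentBundleCore I G).coordChange_self (achart H (1 : G)) 1 (mem_chart_source H 1) u

theorem contDiff_reduced {L : (x : G) → TangentSpace I x → TangentSpace I x → ℝ}
    (hL : SmoothLagrangian I L) :
    ContDiff ℝ ∞ (fun z : E × E => reduced I L z.1 z.2) := by
  rw [← contMDiff_iff_contDiff]
  let ι : E × E → TotalSpace (E × E)
        ((TangentSpace I : G → Type _) ×ᵇ (TangentSpace I : G → Type _)) := fun z => ⟨1, z⟩
  have hι : ContMDiff 𝓘(ℝ, E × E) (I.prod 𝓘(ℝ, E × E)) ∞ ι := by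
    intro z
    rw [contMDiffAt_totalSpace]
    refine ⟨contMDiffAt_const, ?_⟩
    have : (fun x : E × E => (trivializationAt (E × E)
        ((TangentSpace I : G → Type _) ×ᵇ (TangentSpace I : G → Type _)) (ι z).proj (ι x)).2)
        = fun x => x := by
      ext x
      · exact trivializationAt_one_apply x.1
      · exact trivializationAt_one_apply x.2
    rw [this]
    exact contMDiffAt_id
  exact hL.comp hι

end Lagrangian

section Calculus

open MeasureTheory

variable {F : Type*} [NormedAddCommGroup F] [NormedSpace ℝ F]

theorem hasDerivAt_intervalIntegral_param {f f' : ℝ → ℝ → ℝ} (a b : ℝ)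
    (hf : Continuous (Function.uncurry f)) (hf' : Continuous (Function.uncurry f'))
    (hd : ∀ x t, HasDerivAt (fun x => f x t) (f' x t) x) (x₀ : ℝ) :
    HasDerivAt (fun x => ∫ t in a..b, f x t) (∫ t in a..b, f' x₀ t) x₀ := by
  have hc : ∀ x, Continuous (f x) := fun x => hf.comp (Continuous.prodMk_right x)
  have hc' : ∀ x, Continuous (f' x) := fun x => hf'.comp (Continuous.prodMk_right x)
  obtain ⟨C, hC⟩ := ((isCompact_closedBall x₀ 1).prod (isCompact_uIcc (a := a) (b := b))
    ).exists_bound_of_continuousOn hf'.continuousOn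
  refine (intervalIntegral.hasDerivAt_integral_of_dominated_loc_of_deriv_le
    (bound := fun _ => C) (Metric.closedBall_mem_nhds x₀ one_pos)
    (Eventually.of_forall fun x => (hc x).aestronglyMeasurable)
    ((hc x₀).intervalIntegrable _ _) (hc' x₀).aestronglyMeasurable
    (Eventually.of_forall fun t ht x hx => hC (x, t) ⟨hx, uIoc_subset_uIcc ht⟩)
    intervalIntegrable_const (Eventually.of_forall fun t _ x _ => hd x t)).2

theorem hasDerivAt_integral2_param {f : ℝ × (ℝ × ℝ) → ℝ} (hf : ContDiff ℝ ∞ f)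
    (t₁ t₂ s₁ s₂ : ℝ) :
    HasDerivAt (fun ε => ∫ t in t₁..t₂, ∫ s in s₁..s₂, f (ε, (t, s)))
      (∫ t in t₁..t₂, ∫ s in s₁..s₂, fderiv ℝ f (0, (t, s)) (1, 0)) 0 := by
  have hf' : Continuous fun z => fderiv ℝ f z (1, 0) :=
    (hf.continuous_fderiv (by simp)).clm_apply continuous_const
  have hd : ∀ t s ε : ℝ, HasDerivAt (fun ε => f (ε, (t, s))) (fderiv ℝ f (ε, (t, s)) (1, 0)) ε := by
    intro t s ε
    have h1 : HasDerivAt (fun ε : ℝ => (ε, (t, s))) ((1 : ℝ), (0 : ℝ × ℝ)) ε :=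
      (hasDerivAt_id ε).prodMk (hasDerivAt_const ε (t, s))
    exact ((hf.differentiable (by simp)).differentiableAt.hasFDerivAt).comp_hasDerivAt ε h1
  have hi : ∀ {h : ℝ × (ℝ × ℝ) → ℝ}, Continuous h →
      Continuous (Function.uncurry fun ε t => ∫ s in s₁..s₂, h (ε, (t, s))) := by
    intro h hh
    exact intervalIntegral.continuous_parametric_intervalIntegral_of_continuous'
      (f := fun (z : ℝ × ℝ) s => h (z.1, (z.2, s))) (by fun_prop) s₁ s₂
  refine hasDerivAt_intervalIntegral_param t₁ t₂ (hi hf.continuous) (hi hf') (fun ε t => ?_) 0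
  exact hasDerivAt_intervalIntegral_param (f := fun ε s => f (ε, (t, s)))
    (f' := fun ε s => fderiv ℝ f (ε, (t, s)) (1, 0)) s₁ s₂
    (hf.continuous.comp (by fun_prop)) (hf'.comp (by fun_prop)) (fun ε s => hd t s ε) ε

theorem hasDerivAt_fst_line {f : ℝ × ℝ → F} {p : ℝ × ℝ} (hf : DifferentiableAt ℝ f p) :
    HasDerivAt (fun τ : ℝ => f (τ, p.2)) (fderiv ℝ f p (1, 0)) p.1 :=
  HasFDerivAt.comp_hasDerivAt (l := f) p.1 hf.hasFDerivAt
    ((hasDerivAt_id p.1).prodMk (hasDerivAt_const p.1 p.2))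

theorem hasDerivAt_snd_line {f : ℝ × ℝ → F} {p : ℝ × ℝ} (hf : DifferentiableAt ℝ f p) :
    HasDerivAt (fun σ : ℝ => f (p.1, σ)) (fderiv ℝ f p (0, 1)) p.2 :=
  HasFDerivAt.comp_hasDerivAt (l := f) p.2 hf.hasFDerivAt
    ((hasDerivAt_const p.2 p.1).prodMk (hasDerivAt_id p.2))

theorem dT_eq_fderiv {f : ℝ × ℝ → F} {p : ℝ × ℝ} (hf : DifferentiableAt ℝ f p) :
    dT f p = fderiv ℝ f p (1, 0) := (hasDerivAt_fst_line hf).deriv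

theorem dS_eq_fderiv {f : ℝ × ℝ → F} {p : ℝ × ℝ} (hf : DifferentiableAt ℝ f p) :
    dS f p = fderiv ℝ f p (0, 1) := (hasDerivAt_snd_line hf).deriv

theorem contDiff_dT {f : ℝ × ℝ → F} (hf : ContDiff ℝ ∞ f) : ContDiff ℝ ∞ (dT f) := by
  have : dT f = fun p => fderiv ℝ f p (1, 0) :=
    funext fun p => dT_eq_fderiv (hf.differentiable (by simp) p)
  rw [this]
  exact (hf.fderiv_right le_rfl).clm_apply contDiff_const

theorem contDiff_dS {f : ℝ × ℝ → F} (hf : ContDiff ℝ ∞ f) : ContDiff ℝ ∞ (dS f) := by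
  have : dS f = fun p => fderiv ℝ f p (0, 1) :=
    funext fun p => dS_eq_fderiv (hf.differentiable (by simp) p)
  rw [this]
  exact (hf.fderiv_right le_rfl).clm_apply contDiff_const

theorem integral2_divergence_eq_zero {t₁ t₂ s₁ s₂ : ℝ} (ht : t₁ ≤ t₂) (hs : s₁ ≤ s₂)
    {a b : ℝ × ℝ → ℝ} (ha : ContDiff ℝ ∞ a) (hb : ContDiff ℝ ∞ b)
    (ha0 : ∀ p ∈ sides t₁ t₂ s₁ s₂, a p = 0) (hb0 : ∀ p ∈ sides t₁ t₂ s₁ s₂, b p = 0) :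
    ∫ t in t₁..t₂, ∫ s in s₁..s₂, (dT a (t, s) + dS b (t, s)) = 0 := by
  have da := ha.differentiable (by simp)
  have db := hb.differentiable (by simp)
  have hT : ∀ p, dT a p = fderiv ℝ a p (1, 0) := fun p => dT_eq_fderiv (da p)
  have hS : ∀ p, dS b p = fderiv ℝ b p (0, 1) := fun p => dS_eq_fderiv (db p)
  simp only [hT, hS]
  have ca : Continuous fun p => fderiv ℝ a p (1, 0) :=
    (ha.continuous_fderiv (by simp)).clm_apply continuous_const
  have cb : Continuous fun p => fderiv ℝ b p (0, 1) :=
    (hb.continuous_fderiv (by simp)).clm_apply continuous_const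
  rw [integral2_divergence_prod_of_hasFDerivAt a b (fderiv ℝ a) (fderiv ℝ b) t₁ s₁ t₂ s₂
    ha.continuous.continuousOn hb.continuous.continuousOn (fun x _ => (da x).hasFDerivAt)
    (fun x _ => (db x).hasFDerivAt)
    ((ca.add cb).continuousOn.integrableOn_compact (isCompact_uIcc.prod isCompact_uIcc))]
  have e1 : ∀ t ∈ uIcc t₁ t₂, b (t, s₂) = 0 := fun t h => hb0 _
    ⟨⟨uIcc_of_le ht ▸ h, right_mem_Icc.2 hs⟩, by simp⟩
  have e2 : ∀ t ∈ uIcc t₁ t₂, b (t, s₁) = 0 := fun t h => hb0 _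
    ⟨⟨uIcc_of_le ht ▸ h, left_mem_Icc.2 hs⟩, by simp⟩
  have e3 : ∀ s ∈ uIcc s₁ s₂, a (t₂, s) = 0 := fun s h => ha0 _
    ⟨⟨right_mem_Icc.2 ht, uIcc_of_le hs ▸ h⟩, by simp⟩
  have e4 : ∀ s ∈ uIcc s₁ s₂, a (t₁, s) = 0 := fun s h => ha0 _
    ⟨⟨left_mem_Icc.2 ht, uIcc_of_le hs ▸ h⟩, by simp⟩
  rw [intervalIntegral.integral_congr e1, intervalIntegral.integral_congr e2,
    intervalIntegral.integral_congr e3, intervalIntegral.integral_congr e4]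
  simp

/-- The fundamental lemma of the calculus of variations on a rectangle. -/
theorem eq_zero_of_integral2_mul_eq_zero {t₁ t₂ s₁ s₂ : ℝ} (ht : t₁ < t₂) (hs : s₁ < s₂)
    {h : ℝ × ℝ → ℝ} (hc : Continuous h)
    (H : ∀ φ : ℝ × ℝ → ℝ, ContDiff ℝ ∞ φ → (∀ p ∈ sides t₁ t₂ s₁ s₂, φ p = 0) →
      ∫ t in t₁..t₂, ∫ s in s₁..s₂, φ (t, s) * h (t, s) = 0) :
    ∀ p ∈ rect t₁ t₂ s₁ s₂, h p = 0 := by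
  set U : Set (ℝ × ℝ) := Ioo t₁ t₂ ×ˢ Ioo s₁ s₂ with hU
  have hUo : IsOpen U := isOpen_Ioo.prod isOpen_Ioo
  have hae : ∀ᵐ p ∂(volume : Measure (ℝ × ℝ)), p ∈ U → h p = 0 := by
    refine hUo.ae_eq_zero_of_integral_contDiff_smul_eq_zero
      (hc.locallyIntegrable.locallyIntegrableOn _) fun φ hφ _ hsupp => ?_
    have h0 : ∀ p, p ∉ U → φ p = 0 := fun p hp =>
      image_eq_zero_of_notMem_tsupport fun hp' => hp (hsupp hp')
    have := H φ hφ fun p hp => h0 p fun hpU => by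
      rcases hp.2 with h | h | h | h
      · exact absurd hpU.1.1 (by simp [h])
      · exact absurd hpU.1.2 (by simp [h])
      · exact absurd hpU.2.1 (by simp [h])
      · exact absurd hpU.2.2 (by simp [h])
    rw [← setIntegral_eq_integral_of_forall_compl_eq_zero (s := Ioc t₁ t₂ ×ˢ Ioc s₁ s₂),
      Measure.volume_eq_prod, setIntegral_prod]
    · simpa only [intervalIntegral.integral_of_le ht.le, intervalIntegral.integral_of_le hs.le,
        smul_eq_mul] using this
    · exact ((hφ.continuous.smul hc).continuousOn.integrableOn_compact
        (isCompact_Icc.prod isCompact_Icc)).mono_set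
        (prod_mono Ioc_subset_Icc_self Ioc_subset_Icc_self)
    · intro p hp
      rw [h0 p fun hpU => hp ⟨Ioo_subset_Ioc_self hpU.1, Ioo_subset_Ioc_self hpU.2⟩, zero_smul]
  have hU0 : EqOn h (fun _ => 0) U :=
    Measure.eqOn_open_of_ae_eq ((ae_restrict_iff' hUo.measurableSet).2 hae) hUo
      hc.continuousOn continuousOn_const
  have hcl : closure U = rect t₁ t₂ s₁ s₂ := by
    rw [hU, closure_prod_eq, closure_Ioo ht.ne, closure_Ioo hs.ne, rect]
  intro p hp
  exact hU0.closure hc continuous_const (hcl ▸ hp)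

end Calculus

section ReducedCalculus

variable {E : Type*} [NormedAddCommGroup E] [NormedSpace ℝ E]
  {H : Type*} [TopologicalSpace H] {I : ModelWithCorners ℝ E H}
  {G : Type*} [TopologicalSpace G] [ChartedSpace H G] [Group G]
  {l : LieAlg I G → LieAlg I G → ℝ} {t₁ t₂ s₁ s₂ : ℝ} {X Y Z : ℝ × ℝ → LieAlg I G}

theorem contDiff_dlX (hl : ContDiff ℝ ∞ fun z : E × E => l z.1 z.2)
    (hX : ContDiff ℝ ∞ X) (hY : ContDiff ℝ ∞ Y) :
    ContDiff ℝ ∞ fun p => dlX I G l (X p) (Y p) := by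
  have h : ContDiff ℝ ∞ (Function.uncurry fun (p : ℝ × ℝ) (x : E) => l x (Y p)) :=
    hl.comp (contDiff_snd.prodMk (hY.comp contDiff_fst))
  exact h.fderiv hX le_rfl

theorem contDiff_dlY (hl : ContDiff ℝ ∞ fun z : E × E => l z.1 z.2)
    (hX : ContDiff ℝ ∞ X) (hY : ContDiff ℝ ∞ Y) :
    ContDiff ℝ ∞ fun p => dlY I G l (X p) (Y p) := by
  have h : ContDiff ℝ ∞ (Function.uncurry fun (p : ℝ × ℝ) (y : E) => l (X p) y) :=
    hl.comp ((hX.comp contDiff_fst).prodMk contDiff_snd)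
  exact h.fderiv hY le_rfl

theorem fderiv_eq_dlX_add_dlY (hl : ContDiff ℝ ∞ fun z : E × E => l z.1 z.2) (x y u v : E) :
    fderiv ℝ (fun z : E × E => l z.1 z.2) (x, y) (u, v) =
      dlX I G l x y u + dlY I G l x y v := by
  have hd := (hl.differentiable (by simp) (x, y)).hasFDerivAt
  have h1 : dlX I G l x y = _ := (HasFDerivAt.comp (f := fun x' : E => (x', y))
    (g := fun z : E × E => l z.1 z.2) x hd (hasFDerivAt_prodMk_left x y)).fderiv
  have h2 : dlY I G l x y = _ := (HasFDerivAt.comp (f := fun y' : E => (x, y'))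
    (g := fun z : E × E => l z.1 z.2) y hd (hasFDerivAt_prodMk_right x y)).fderiv
  rw [h1, h2]
  simp [← map_add]

variable [FiniteDimensional ℝ E] [LieGroup I ∞ G]

variable (I G) in
theorem isLinearMap_ad : IsLinearMap ℝ (fun x : LieAlg I G => ad I G x) := by
  have : CompleteSpace E := FiniteDimensional.complete ℝ E
  have : LieGroup I (minSmoothness ℝ 3) G := LieGroup.of_le (n := ∞) (by
    rw [minSmoothness_of_isRCLikeNormedField]
    exact ENat.LEInfty.out)
  constructor
  · intro x y
    ext z
    exact add_lie (L := GroupLieAlgebra I G) (M := GroupLieAlgebra I G) x y z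
  · intro c x
    ext z
    exact smul_lie (R := ℝ) (L := GroupLieAlgebra I G) (M := GroupLieAlgebra I G) c x z

variable (I G) in
theorem contDiff_ad : ContDiff ℝ ∞ (fun x : LieAlg I G => ad I G x) :=
  (LinearMap.toContinuousLinearMap (IsLinearMap.mk' _ (isLinearMap_ad I G))).contDiff

variable (I G) in
/-- The variation `δX = Z_t + ad_X Z`. -/
def deltaX (X Z : ℝ × ℝ → LieAlg I G) (p : ℝ × ℝ) : LieAlg I G := dT Z p + ad I G (X p) (Z p)

variable (I G) in
/-- The variation `δY = Z_s + ad_Y Z`. -/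
def deltaY (Y Z : ℝ × ℝ → LieAlg I G) (p : ℝ × ℝ) : LieAlg I G := dS Z p + ad I G (Y p) (Z p)

theorem contDiff_deltaX (hX : ContDiff ℝ ∞ X) (hZ : ContDiff ℝ ∞ Z) :
    ContDiff ℝ ∞ (deltaX I G X Z) :=
  (contDiff_dT hZ).add (((contDiff_ad I G).comp hX).clm_apply hZ)

theorem contDiff_deltaY (hY : ContDiff ℝ ∞ Y) (hZ : ContDiff ℝ ∞ Z) :
    ContDiff ℝ ∞ (deltaY I G Y Z) :=
  (contDiff_dS hZ).add (((contDiff_ad I G).comp hY).clm_apply hZ)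

variable (I G) in
/-- The first variation of the reduced action in the direction given by `Z`. -/
def firstVariation (l : LieAlg I G → LieAlg I G → ℝ) (t₁ t₂ s₁ s₂ : ℝ)
    (X Y Z : ℝ × ℝ → LieAlg I G) : ℝ :=
  ∫ t in t₁..t₂, ∫ s in s₁..s₂,
    (dlX I G l (X (t, s)) (Y (t, s)) (deltaX I G X Z (t, s))
      + dlY I G l (X (t, s)) (Y (t, s)) (deltaY I G Y Z (t, s)))

variable (I G) in
/-- The left-hand side of the Euler–Poincaré equations. -/
def eulerPoincareExpr (l : LieAlg I G → LieAlg I G → ℝ) (X Y : ℝ × ℝ → LieAlg I G)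
    (p : ℝ × ℝ) : LieAlg I G →L[ℝ] ℝ :=
  dT (fun r => dlX I G l (X r) (Y r)) p - adStar I G (X p) (dlX I G l (X p) (Y p))
    + dS (fun r => dlY I G l (X r) (Y r)) p - adStar I G (Y p) (dlY I G l (X p) (Y p))

theorem continuous_eulerPoincareExpr (hl : ContDiff ℝ ∞ fun z : E × E => l z.1 z.2)
    (hX : ContDiff ℝ ∞ X) (hY : ContDiff ℝ ∞ Y) :
    Continuous (eulerPoincareExpr I G l X Y) := by
  have h1 := contDiff_dlX hl hX hY
  have h2 := contDiff_dlY hl hX hY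
  exact ((((contDiff_dT h1).sub (h1.clm_comp ((contDiff_ad I G).comp hX))).add
    (contDiff_dS h2)).sub (h2.clm_comp ((contDiff_ad I G).comp hY))).continuous

theorem hasDerivAt_reducedAction (hl : ContDiff ℝ ∞ fun z : E × E => l z.1 z.2)
    {ξ η : ℝ × (ℝ × ℝ) → LieAlg I G} (hξ : ContDiff ℝ ∞ ξ) (hη : ContDiff ℝ ∞ η)
    (hξ0 : ∀ p, ξ (0, p) = X p) (hη0 : ∀ p, η (0, p) = Y p)
    (hdξ : ∀ p, deriv (fun ε : ℝ => ξ (ε, p)) 0 = deltaX I G X Z p)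
    (hdη : ∀ p, deriv (fun ε : ℝ => η (ε, p)) 0 = deltaY I G Y Z p) :
    HasDerivAt
      (fun ε : ℝ => ∫ t in t₁..t₂, ∫ s in s₁..s₂, l (ξ (ε, (t, s))) (η (ε, (t, s))))
      (firstVariation I G l t₁ t₂ s₁ s₂ X Y Z) 0 := by
  have h := hasDerivAt_integral2_param (hl.comp (hξ.prodMk hη)) t₁ t₂ s₁ s₂
  have hline : ∀ (t s : ℝ) {f : ℝ × (ℝ × ℝ) → E}, ContDiff ℝ ∞ f →
      fderiv ℝ f (0, (t, s)) (1, 0) = deriv (fun ε : ℝ => f (ε, (t, s))) 0 := by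
    intro t s f hf
    have h1 : HasDerivAt (fun ε : ℝ => (ε, (t, s))) ((1 : ℝ), (0 : ℝ × ℝ)) 0 :=
      (hasDerivAt_id (0 : ℝ)).prodMk (hasDerivAt_const 0 (t, s))
    exact (((hf.differentiable (by simp)).differentiableAt.hasFDerivAt).comp_hasDerivAt 0
      h1).deriv.symm
  have hpt : ∀ t s : ℝ, fderiv ℝ ((fun z : E × E => l z.1 z.2) ∘ fun z => (ξ z, η z))
      (0, (t, s)) (1, 0) = dlX I G l (X (t, s)) (Y (t, s)) (deltaX I G X Z (t, s))
        + dlY I G l (X (t, s)) (Y (t, s)) (deltaY I G Y Z (t, s)) := by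
    intro t s
    have dξ := hξ.differentiable (by simp) (0, (t, s))
    have dη := hη.differentiable (by simp) (0, (t, s))
    rw [fderiv_comp _ (hl.differentiable (by simp) _) (dξ.prodMk dη), dξ.fderiv_prodMk dη]
    simp only [ContinuousLinearMap.comp_apply, ContinuousLinearMap.prod_apply]
    rw [fderiv_eq_dlX_add_dlY (I := I) (G := G) hl, hline t s hξ, hline t s hη, hdξ, hdη, hξ0,
      hη0]
  simp only [hpt] at h
  exact h

theorem firstVariation_eq (ht : t₁ ≤ t₂) (hs : s₁ ≤ s₂)
    (hl : ContDiff ℝ ∞ fun z : E × E => l z.1 z.2)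
    (hX : ContDiff ℝ ∞ X) (hY : ContDiff ℝ ∞ Y) (hZ : ContDiff ℝ ∞ Z)
    (hZ0 : ∀ p ∈ sides t₁ t₂ s₁ s₂, Z p = 0) :
    firstVariation I G l t₁ t₂ s₁ s₂ X Y Z =
      - ∫ t in t₁..t₂, ∫ s in s₁..s₂, eulerPoincareExpr I G l X Y (t, s) (Z (t, s)) := by
  have h1 := contDiff_dlX hl hX hY
  have h2 := contDiff_dlY hl hX hY
  set μ := fun p => dlX I G l (X p) (Y p) with hμ
  set ν := fun p => dlY I G l (X p) (Y p) with hν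
  have ha : ContDiff ℝ ∞ fun p => μ p (Z p) := h1.clm_apply hZ
  have hb : ContDiff ℝ ∞ fun p => ν p (Z p) := h2.clm_apply hZ
  have hdiv := integral2_divergence_eq_zero ht hs ha hb
    (fun p hp => by rw [hZ0 p hp, map_zero]) (fun p hp => by rw [hZ0 p hp, map_zero])
  have hTa : ∀ p, dT (fun p => μ p (Z p)) p = dT μ p (Z p) + μ p (dT Z p) := fun p =>
    ((hasDerivAt_fst_line (h1.differentiable (by simp) p)).clm_apply
      (hasDerivAt_fst_line (hZ.differentiable (by simp) p))).deriv.trans (by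
        rw [dT_eq_fderiv (h1.differentiable (by simp) p),
          dT_eq_fderiv (hZ.differentiable (by simp) p)])
  have hSb : ∀ p, dS (fun p => ν p (Z p)) p = dS ν p (Z p) + ν p (dS Z p) := fun p =>
    ((hasDerivAt_snd_line (h2.differentiable (by simp) p)).clm_apply
      (hasDerivAt_snd_line (hZ.differentiable (by simp) p))).deriv.trans (by
        rw [dS_eq_fderiv (h2.differentiable (by simp) p),
          dS_eq_fderiv (hZ.differentiable (by simp) p)])
  have hpt : ∀ p, μ p (deltaX I G X Z p) + ν p (deltaY I G Y Z p) =
      (dT (fun p => μ p (Z p)) p + dS (fun p => ν p (Z p)) p)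
        - eulerPoincareExpr I G l X Y p (Z p) := by
    intro p
    rw [hTa, hSb]
    simp only [eulerPoincareExpr, deltaX, deltaY, adStar, map_add, ← hμ, ← hν,
      sub_apply, add_apply,
      ContinuousLinearMap.comp_apply]
    simp only [hμ, hν]
    ring
  have hc1 : Continuous fun p => dT (fun p => μ p (Z p)) p + dS (fun p => ν p (Z p)) p :=
    ((contDiff_dT ha).add (contDiff_dS hb)).continuous
  have hc2 : Continuous fun p => eulerPoincareExpr I G l X Y p (Z p) :=
    (continuous_eulerPoincareExpr hl hX hY).clm_apply hZ.continuous
  have hi : ∀ {f : ℝ × ℝ → ℝ}, Continuous f → Continuous fun t => ∫ s in s₁..s₂, f (t, s) :=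
    fun {f} hf => intervalIntegral.continuous_parametric_intervalIntegral_of_continuous'
      (f := fun t s => f (t, s)) (by fun_prop) s₁ s₂
  have hsub : ∀ t, ∫ s in s₁..s₂, (μ (t, s) (deltaX I G X Z (t, s))
        + ν (t, s) (deltaY I G Y Z (t, s))) =
      (∫ s in s₁..s₂, (dT (fun p => μ p (Z p)) (t, s) + dS (fun p => ν p (Z p)) (t, s)))
        - ∫ s in s₁..s₂, eulerPoincareExpr I G l X Y (t, s) (Z (t, s)) := by
    intro t
    simp only [hpt]
    exact intervalIntegral.integral_sub
      ((hc1.comp (Continuous.prodMk_right t)).intervalIntegrable _ _)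
      ((hc2.comp (Continuous.prodMk_right t)).intervalIntegrable _ _)
  change ∫ t in t₁..t₂, ∫ s in s₁..s₂, (μ (t, s) (deltaX I G X Z (t, s))
        + ν (t, s) (deltaY I G Y Z (t, s))) = _
  simp only [hsub]
  rw [intervalIntegral.integral_sub ((hi hc1).intervalIntegrable _ _)
    ((hi hc2).intervalIntegrable _ _), hdiv, zero_sub]

theorem eulerPoincare_iff_firstVariation (ht : t₁ < t₂) (hs : s₁ < s₂)
    (hl : ContDiff ℝ ∞ fun z : E × E => l z.1 z.2)
    (hX : ContDiff ℝ ∞ X) (hY : ContDiff ℝ ∞ Y) :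
    EulerPoincare I G l t₁ t₂ s₁ s₂ X Y ↔
      ∀ Z : ℝ × ℝ → LieAlg I G, ContDiff ℝ ∞ Z → (∀ p ∈ sides t₁ t₂ s₁ s₂, Z p = 0) →
        firstVariation I G l t₁ t₂ s₁ s₂ X Y Z = 0 := by
  constructor
  · intro h Z hZ hZ0
    rw [firstVariation_eq ht.le hs.le hl hX hY hZ hZ0, neg_eq_zero]
    have h0 : ∀ t ∈ uIcc t₁ t₂,
        ∫ s in s₁..s₂, eulerPoincareExpr I G l X Y (t, s) (Z (t, s)) = 0 := by
      intro t ht'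
      have h1 : ∀ s ∈ uIcc s₁ s₂, eulerPoincareExpr I G l X Y (t, s) (Z (t, s)) = 0 := by
        intro s hs'
        have : eulerPoincareExpr I G l X Y (t, s) = 0 :=
          h (t, s) ⟨uIcc_of_le ht.le ▸ ht', uIcc_of_le hs.le ▸ hs'⟩
        rw [this]; rfl
      rw [intervalIntegral.integral_congr h1]
      simp
    rw [intervalIntegral.integral_congr h0]
    simp
  · intro h p hp
    change eulerPoincareExpr I G l X Y p = 0
    ext e
    refine eq_zero_of_integral2_mul_eq_zero ht hs
      ((continuous_eulerPoincareExpr hl hX hY).clm_apply continuous_const) ?_ p hp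
    intro φ hφ hφ0
    have hZ : ContDiff ℝ ∞ fun p => φ p • e := hφ.smul contDiff_const
    have hZ0 : ∀ p ∈ sides t₁ t₂ s₁ s₂, φ p • e = 0 := fun p hp => by rw [hφ0 p hp, zero_smul]
    have h1 := h _ hZ hZ0
    rw [firstVariation_eq ht.le hs.le hl hX hY hZ hZ0, neg_eq_zero] at h1
    simpa only [map_smul, smul_eq_mul] using h1

theorem constrainedPrinciple_iff_firstVariation
    (hl : ContDiff ℝ ∞ fun z : E × E => l z.1 z.2)
    (hX : ContDiff ℝ ∞ X) (hY : ContDiff ℝ ∞ Y) :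
    ConstrainedPrinciple I G l t₁ t₂ s₁ s₂ X Y ↔
      ∀ Z : ℝ × ℝ → LieAlg I G, ContDiff ℝ ∞ Z → (∀ p ∈ sides t₁ t₂ s₁ s₂, Z p = 0) →
        firstVariation I G l t₁ t₂ s₁ s₂ X Y Z = 0 := by
  constructor
  · intro h Z hZ hZ0
    have smooth : ∀ {V W : ℝ × ℝ → LieAlg I G}, ContDiff ℝ ∞ V → ContDiff ℝ ∞ W →
        ContDiff ℝ ∞ fun z : ℝ × (ℝ × ℝ) => V z.2 + z.1 • W z.2 := fun hV hW =>
      (hV.comp contDiff_snd).add (contDiff_fst.smul (hW.comp contDiff_snd))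
    have hderiv : ∀ V W : LieAlg I G, deriv (fun ε : ℝ => V + ε • W) 0 = W := fun V W => by
      simpa using (((hasDerivAt_id (0 : ℝ)).smul_const W).const_add V).deriv
    have hξ := smooth hX (contDiff_deltaX hX hZ)
    have hη := smooth hY (contDiff_deltaY hY hZ)
    exact (hasDerivAt_reducedAction hl hξ hη (fun p => by simp) (fun p => by simp)
      (fun p => hderiv (X p) (deltaX I G X Z p)) (fun p => hderiv (Y p) (deltaY I G Y Z p))).unique
      (h Z _ _ hZ hZ0 hξ hη (fun p => by simp) (fun p => by simp)
      (fun p => hderiv (X p) (deltaX I G X Z p)) (fun p => hderiv (Y p) (deltaY I G Y Z p)))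
  · intro h Z ξ η hZ hZ0 hξ hη hξ0 hη0 hdξ hdη
    have := hasDerivAt_reducedAction (t₁ := t₁) (t₂ := t₂) (s₁ := s₁) (s₂ := s₂) hl hξ hη hξ0 hη0
      hdξ hdη
    rwa [h Z hZ hZ0] at this

end ReducedCalculus

section Hamilton

variable {E : Type*} [NormedAddCommGroup E] [NormedSpace ℝ E]
  {H : Type*} [TopologicalSpace H] {I : ModelWithCorners ℝ E H}
  {G : Type*} [TopologicalSpace G] [ChartedSpace H G]
  {N : Type*} [NormedAddCommGroup N] [NormedSpace ℝ N]

theorem contMDiff_slice {Γ : ℝ × (ℝ × ℝ) → G} (hΓ : ContMDiff 𝓘(ℝ, ℝ × (ℝ × ℝ)) I ∞ Γ) (ε : ℝ) :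
    ContMDiff 𝓘(ℝ, ℝ × ℝ) I ∞ fun p => Γ (ε, p) := by
  have h : ContMDiff 𝓘(ℝ, ℝ × ℝ) 𝓘(ℝ, ℝ × (ℝ × ℝ)) ∞ fun p : ℝ × ℝ => (ε, p) :=
    (contDiff_prodMk_right ε).contMDiff
  exact hΓ.comp h

variable [Group G]

theorem mcForm_const_mul (x : G) (f : N → G) (p : N) :
    mcForm I (fun r => x * f r) p = mcForm I f p := by
  simp only [mcForm, mul_inv_rev, mul_assoc, inv_mul_cancel_left]

theorem action_eq_reduced {L : (x : G) → TangentSpace I x → TangentSpace I x → ℝ}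
    (hL : LeftInvariant I L) (t₁ t₂ s₁ s₂ : ℝ) (g : ℝ × ℝ → G) :
    action I L t₁ t₂ s₁ s₂ g = ∫ t in t₁..t₂, ∫ s in s₁..s₂,
      reduced I L (fieldX I g (t, s)) (fieldY I g (t, s)) := by
  simp only [action, fieldX, fieldY, reduced_leftTriv I hL]

variable [LieGroup I ∞ G]

/-- `f⁻¹ df` along a curve in the domain of `f`. -/
theorem leftTriv_mfderiv_comp {f : N → G} {c : ℝ → N} {x : ℝ} {v : N}
    (hf : MDifferentiableAt 𝓘(ℝ, N) I f (c x)) (hc : HasDerivAt c v x) :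
    leftTriv I (f (c x)) (mfderiv 𝓘(ℝ, ℝ) I (fun τ => f (c τ)) x (1 : ℝ)) =
      mcForm I f (c x) v := by
  have h : MDifferentiableAt 𝓘(ℝ, ℝ) I (fun τ => f (c τ)) x :=
    hf.comp x hc.differentiableAt.mdifferentiableAt
  refine (mcForm_apply h (1 : ℝ)).symm.trans ?_
  rw [mcForm_comp hf hc.differentiableAt]
  simp [hc.deriv]

theorem fieldX_eq_mcForm {g : ℝ × ℝ → G} {p : ℝ × ℝ}
    (hg : MDifferentiableAt 𝓘(ℝ, ℝ × ℝ) I g p) : fieldX I g p = mcForm I g p (1, 0) :=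
  leftTriv_mfderiv_comp (c := fun τ => (τ, p.2)) (x := p.1) hg
    ((hasDerivAt_id p.1).prodMk (hasDerivAt_const p.1 p.2))

theorem fieldY_eq_mcForm {g : ℝ × ℝ → G} {p : ℝ × ℝ}
    (hg : MDifferentiableAt 𝓘(ℝ, ℝ × ℝ) I g p) : fieldY I g p = mcForm I g p (0, 1) :=
  leftTriv_mfderiv_comp (c := fun σ => (p.1, σ)) (x := p.2) hg
    ((hasDerivAt_const p.2 p.1).prodMk (hasDerivAt_id p.2))

theorem contDiff_fieldX {g : ℝ × ℝ → G} (hg : ContMDiff 𝓘(ℝ, ℝ × ℝ) I ∞ g) :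
    ContDiff ℝ ∞ (fieldX I g) := by
  rw [show fieldX I g = fun p => mcForm I g p (1, 0) from
    funext fun p => fieldX_eq_mcForm (hg.mdifferentiable (by simp) p)]
  exact (contDiff_mcForm hg).clm_apply contDiff_const

theorem contDiff_fieldY {g : ℝ × ℝ → G} (hg : ContMDiff 𝓘(ℝ, ℝ × ℝ) I ∞ g) :
    ContDiff ℝ ∞ (fieldY I g) := by
  rw [show fieldY I g = fun p => mcForm I g p (0, 1) from
    funext fun p => fieldY_eq_mcForm (hg.mdifferentiable (by simp) p)]
  exact (contDiff_mcForm hg).clm_apply contDiff_const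

theorem mcForm_slice {Γ : ℝ × (ℝ × ℝ) → G} (hΓ : ContMDiff 𝓘(ℝ, ℝ × (ℝ × ℝ)) I ∞ Γ)
    (ε : ℝ) (p v : ℝ × ℝ) :
    mcForm I (fun p => Γ (ε, p)) p v = mcForm I Γ (ε, p) (0, v) := by
  have hd := hasFDerivAt_prodMk_right (𝕜 := ℝ) ε p
  rw [mcForm_comp (f := Γ) (h := fun p => (ε, p)) (hΓ.mdifferentiable (by simp) _)
    hd.differentiableAt, hd.fderiv]
  simp

variable [FiniteDimensional ℝ E] [I.Boundaryless]

theorem deriv_mcForm_slice {Γ : ℝ × (ℝ × ℝ) → G} (hΓ : ContMDiff 𝓘(ℝ, ℝ × (ℝ × ℝ)) I ∞ Γ)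
    (p v : ℝ × ℝ) :
    deriv (fun ε : ℝ => mcForm I Γ (ε, p) (0, v)) 0 =
      fderiv ℝ (fun p => mcForm I Γ (0, p) (1, 0)) p v +
        ad I G (mcForm I Γ (0, p) (0, v)) (mcForm I Γ (0, p) (1, 0)) := by
  have hd : DifferentiableAt ℝ (mcForm I Γ) (0, p) :=
    (contDiff_mcForm hΓ).differentiable (by simp) _
  have h1 : HasDerivAt (fun ε : ℝ => mcForm I Γ (ε, p) (0, v))
      (fderiv ℝ (mcForm I Γ) (0, p) (1, 0) (0, v)) 0 := by
    have hl : HasDerivAt (fun ε : ℝ => (ε, p)) ((1 : ℝ), (0 : ℝ × ℝ)) 0 :=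
      (hasDerivAt_id (0 : ℝ)).prodMk (hasDerivAt_const 0 p)
    simpa using (HasFDerivAt.comp_hasDerivAt (l := mcForm I Γ) 0 hd.hasFDerivAt hl).clm_apply
      (hasDerivAt_const (0 : ℝ) ((0 : ℝ), v))
  have h2 : fderiv ℝ (fun p => mcForm I Γ (0, p) (1, 0)) p v =
      fderiv ℝ (mcForm I Γ) (0, p) (0, v) (1, 0) := by
    have hc := HasFDerivAt.comp (g := mcForm I Γ) p hd.hasFDerivAt
      (hasFDerivAt_prodMk_right (𝕜 := ℝ) (0 : ℝ) p)
    have := (hc.clm_apply (hasFDerivAt_const ((1 : ℝ), (0 : ℝ × ℝ)) p)).fderiv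
    simp only [Function.comp_def] at this
    rw [this]
    simp
  rw [h1.deriv, h2, ← mcForm_structure (hΓ (0, p))]
  abel

theorem hasDerivAt_action {L : (x : G) → TangentSpace I x → TangentSpace I x → ℝ}
    (hL : SmoothLagrangian I L) (hinv : LeftInvariant I L) {t₁ t₂ s₁ s₂ : ℝ}
    {g : ℝ × ℝ → G} {Γ : ℝ × (ℝ × ℝ) → G} (hΓ : ContMDiff 𝓘(ℝ, ℝ × (ℝ × ℝ)) I ∞ Γ)
    (hg : ∀ p, Γ (0, p) = g p) :
    HasDerivAt (fun ε : ℝ => action I L t₁ t₂ s₁ s₂ fun p => Γ (ε, p))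
      (firstVariation I G (reduced I L) t₁ t₂ s₁ s₂ (fieldX I g) (fieldY I g)
        fun p => mcForm I Γ (0, p) (1, 0)) 0 := by
  have hg' : g = fun p => Γ (0, p) := funext fun p => (hg p).symm
  have hsm := contDiff_mcForm hΓ
  have hmd := fun ε p => (contMDiff_slice hΓ ε).mdifferentiable (by simp) p
  have hX : ∀ ε p, fieldX I (fun p => Γ (ε, p)) p = mcForm I Γ (ε, p) (0, (1, 0)) :=
    fun ε p => (fieldX_eq_mcForm (hmd ε p)).trans (mcForm_slice hΓ ε p _)
  have hY : ∀ ε p, fieldY I (fun p => Γ (ε, p)) p = mcForm I Γ (ε, p) (0, (0, 1)) :=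
    fun ε p => (fieldY_eq_mcForm (hmd ε p)).trans (mcForm_slice hΓ ε p _)
  have hZ : ContDiff ℝ ∞ fun p : ℝ × ℝ => mcForm I Γ (0, p) (1, 0) :=
    (hsm.comp (contDiff_prodMk_right 0)).clm_apply contDiff_const
  simp only [action_eq_reduced hinv, hX, hY]
  refine hasDerivAt_reducedAction (I := I) (G := G) (contDiff_reduced hL)
    (ξ := fun z => mcForm I Γ z (0, (1, 0))) (η := fun z => mcForm I Γ z (0, (0, 1)))
    (hsm.clm_apply contDiff_const) (hsm.clm_apply contDiff_const) (fun p => ?_) (fun p => ?_)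
    (fun p => ?_) (fun p => ?_)
  · rw [hg', hX]
  · rw [hg', hY]
  · rw [deriv_mcForm_slice hΓ, deltaX, dT_eq_fderiv (hZ.differentiable (by simp) p), hg', hX]
  · rw [deriv_mcForm_slice hΓ, deltaY, dS_eq_fderiv (hZ.differentiable (by simp) p), hg', hY]

variable (I G) in
/-- There is a smooth map `𝔤 → G` which is tangent at the origin to the exponential map. -/
theorem exists_smooth_retraction : ∃ σ : E → G, ContMDiff 𝓘(ℝ, E) I ∞ σ ∧ σ 0 = 1 ∧
    mcForm I σ 0 = ContinuousLinearMap.id ℝ E := by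
  set χ := extChartAt I (1 : G) with hχ
  obtain ⟨c, hc, hball⟩ := Metric.mem_nhds_iff.1 (extChartAt_target_mem_nhds (I := I) (1 : G))
  let β : ContDiffBump (0 : E) := ⟨c / 2, c, half_pos hc, half_lt_self hc⟩
  let κ : E → E := fun v => χ 1 + β v • v
  have hκt : ∀ v, κ v ∈ χ.target := fun v => by
    apply hball
    rw [mem_ball_iff_norm, add_sub_cancel_left, norm_smul, Real.norm_of_nonneg β.nonneg]
    by_cases hv : ‖v‖ < c
    · exact (mul_le_of_le_one_left (norm_nonneg v) β.le_one).trans_lt hv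
    · rw [β.zero_of_le_dist (by simpa using hv), zero_mul]
      exact hc
  have hκ : ContDiff ℝ ∞ κ := contDiff_const.add (β.contDiff.smul contDiff_id)
  have hσ1 : χ.symm (κ 0) = 1 := by simp [κ, hχ]
  refine ⟨fun v => χ.symm (κ v), fun v => ?_, hσ1, ?_⟩
  · have h : ContMDiffAt 𝓘(ℝ, E) I ∞ χ.symm (κ v) :=
      (contMDiffOn_extChartAt_symm (1 : G)).contMDiffAt
        ((isOpen_extChartAt_target (1 : G)).mem_nhds (hκt v))
    exact h.comp v hκ.contMDiff.contMDiffAt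
  · have hev : (fun r => χ ((χ.symm (κ 0))⁻¹ * χ.symm (κ r))) =ᶠ[𝓝 0] fun r => χ 1 + r := by
      filter_upwards [β.eventuallyEq_one] with r hr
      rw [hσ1, inv_one, one_mul, χ.right_inv (hκt r)]
      simp only [κ, hr, Pi.one_apply, one_smul]
    rw [mcForm, hev.fderiv_eq]
    exact ((hasFDerivAt_id (0 : E)).const_add (χ 1)).fderiv

theorem hamiltonPrinciple_iff_firstVariation
    {L : (x : G) → TangentSpace I x → TangentSpace I x → ℝ}
    (hL : SmoothLagrangian I L) (hinv : LeftInvariant I L) {t₁ t₂ s₁ s₂ : ℝ}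
    {g : ℝ × ℝ → G} (hg : ContMDiff 𝓘(ℝ, ℝ × ℝ) I ∞ g) :
    HamiltonPrinciple I L t₁ t₂ s₁ s₂ g ↔
      ∀ Z : ℝ × ℝ → LieAlg I G, ContDiff ℝ ∞ Z → (∀ p ∈ sides t₁ t₂ s₁ s₂, Z p = 0) →
        firstVariation I G (reduced I L) t₁ t₂ s₁ s₂ (fieldX I g) (fieldY I g) Z = 0 := by
  have hline : ∀ p : ℝ × ℝ, HasDerivAt (fun ε : ℝ => (ε, p)) ((1 : ℝ), (0 : ℝ × ℝ)) 0 := fun p =>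
    (hasDerivAt_id (0 : ℝ)).prodMk (hasDerivAt_const 0 p)
  constructor
  · intro h Z hZ hZ0
    obtain ⟨σ, hσ, hσ0, hσ'⟩ := exists_smooth_retraction I G
    set Γ : ℝ × (ℝ × ℝ) → G := fun z => g z.2 * σ (z.1 • Z z.2) with hΓd
    have hΓ : ContMDiff 𝓘(ℝ, ℝ × (ℝ × ℝ)) I ∞ Γ := by
      have h1 : ContMDiff 𝓘(ℝ, ℝ × (ℝ × ℝ)) I ∞ fun z : ℝ × (ℝ × ℝ) => g z.2 :=
        hg.comp (f := (Prod.snd : ℝ × (ℝ × ℝ) → ℝ × ℝ)) contDiff_snd.contMDiff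
      have h2 : ContMDiff 𝓘(ℝ, ℝ × (ℝ × ℝ)) I ∞ fun z : ℝ × (ℝ × ℝ) => σ (z.1 • Z z.2) :=
        hσ.comp (f := fun z : ℝ × (ℝ × ℝ) => z.1 • Z z.2)
          (contDiff_fst.smul (hZ.comp contDiff_snd)).contMDiff
      exact h1.mul h2
    have hΓ0 : ∀ p, Γ (0, p) = g p := fun p => by simp [hΓd, hσ0]
    have hdef : IsDeformation I t₁ t₂ s₁ s₂ g Γ := by
      refine ⟨hΓ, hΓ0, fun p hp => ?_⟩
      have : (fun ε : ℝ => Γ (ε, p)) = fun _ => Γ (0, p) := by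
        ext ε; simp [hΓd, hZ0 p hp]
      rw [this, mfderiv_const]
      rfl
    have hZΓ : (fun p => mcForm I Γ (0, p) (1, 0)) = Z := by
      ext p
      have hd : HasDerivAt (fun ε : ℝ => ε • Z p) (Z p) 0 := by
        simpa using (hasDerivAt_id (0 : ℝ)).smul_const (Z p)
      have e1 : mcForm I (fun ε : ℝ => Γ (ε, p)) 0 1 = mcForm I Γ (0, p) (1, 0) := by
        rw [mcForm_comp (f := Γ) (h := fun ε : ℝ => (ε, p)) (hΓ.mdifferentiable (by simp) _)
          (hline p).differentiableAt]
        simp [(hline p).deriv]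
      have e2 : mcForm I (fun ε : ℝ => Γ (ε, p)) 0 1 = Z p := by
        rw [show (fun ε : ℝ => Γ (ε, p)) = fun ε => g p * σ (ε • Z p) from rfl, mcForm_const_mul,
          mcForm_comp (f := σ) (h := fun ε : ℝ => ε • Z p) (hσ.mdifferentiable (by simp) _)
          hd.differentiableAt, zero_smul, hσ']
        simp [hd.deriv]
      exact e1.symm.trans e2
    have := hasDerivAt_action hL hinv (t₁ := t₁) (t₂ := t₂) (s₁ := s₁) (s₂ := s₂) hΓ hΓ0
    rw [hZΓ] at this
    exact this.unique (h Γ hdef)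
  · intro h Γ hΓ
    have hd := hasDerivAt_action hL hinv (t₁ := t₁) (t₂ := t₂) (s₁ := s₁) (s₂ := s₂) hΓ.smooth
      hΓ.base
    rwa [h] at hd
    · exact ((contDiff_mcForm hΓ.smooth).comp (contDiff_prodMk_right 0)).clm_apply contDiff_const
    · intro p hp
      have h1 := leftTriv_mfderiv_comp (c := fun ε : ℝ => (ε, p))
        (hΓ.smooth.mdifferentiable (by simp) (0, p)) (hline p)
      rw [← h1, hΓ.fixed p hp]
      exact map_zero (mfderiv I I (fun y => (Γ (0, p))⁻¹ * y) (Γ (0, p)))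

end Hamilton

section EulerLagrangeEquations

theorem dT_congr {F : Type*} [NormedAddCommGroup F] [NormedSpace ℝ F] {f f' : ℝ × ℝ → F}
    {p : ℝ × ℝ} (h : f =ᶠ[𝓝 p] f') : dT f p = dT f' p :=
  Filter.EventuallyEq.deriv_eq <|
    (show Continuous fun τ : ℝ => (τ, p.2) by fun_prop).continuousAt.eventually h

theorem dS_congr {F : Type*} [NormedAddCommGroup F] [NormedSpace ℝ F] {f f' : ℝ × ℝ → F}
    {p : ℝ × ℝ} (h : f =ᶠ[𝓝 p] f') : dS f p = dS f' p :=
  Filter.EventuallyEq.deriv_eq <|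
    (show Continuous fun σ : ℝ => (p.1, σ) by fun_prop).continuousAt.eventually h

variable {E : Type*} [NormedAddCommGroup E] [NormedSpace ℝ E]
  {H : Type*} [TopologicalSpace H] {I : ModelWithCorners ℝ E H} [I.Boundaryless]
  {G : Type*} [TopologicalSpace G] [ChartedSpace H G] [Group G] [LieGroup I ∞ G]
  {L : (x : G) → TangentSpace I x → TangentSpace I x → ℝ}

theorem coordLagrangian_eq_reduced (hinv : LeftInvariant I L) {φ : OpenPartialHomeomorph G H}
    (hφ : φ ∈ IsManifold.maximalAtlas I ∞ G) {q : E} (hq : q ∈ (φ.extend I).target) (u v : E) :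
    coordLagrangian I L φ q u v =
      reduced I L (mcForm I (φ.extend I).symm q u) (mcForm I (φ.extend I).symm q v) := by
  have h1 : MDifferentiableAt 𝓘(ℝ, E) I (φ.extend I).symm q :=
    (contMDiffAt_chart_symm hφ hq).mdifferentiableAt (by simp)
  rw [mcForm_apply h1, mcForm_apply h1, reduced_leftTriv I hinv, coordLagrangian]

variable [FiniteDimensional ℝ E]

theorem eulerLagrangeExpr_apply (hL : SmoothLagrangian I L) (hinv : LeftInvariant I L)
    {g : ℝ × ℝ → G} (hg : ContMDiff 𝓘(ℝ, ℝ × ℝ) I ∞ g) {φ : OpenPartialHomeomorph G H}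
    (hφ : φ ∈ IsManifold.maximalAtlas I ∞ G) {p : ℝ × ℝ} (hp : g p ∈ φ.source) (w : E) :
    eulerLagrangeExpr (coordLagrangian I L φ) (fun r => φ.extend I (g r)) p w =
      - eulerPoincareExpr I G (reduced I L) (fieldX I g) (fieldY I g) p
        (mcForm I (φ.extend I).symm (φ.extend I (g p)) w) := by
  set l := reduced I L
  have hl : ContDiff ℝ ∞ fun z : E × E => l z.1 z.2 := contDiff_reduced hL
  set X := fieldX I g
  set Y := fieldY I g
  set A := mcForm I (φ.extend I).symm
  set q : ℝ × ℝ → E := fun r => φ.extend I (g r)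
  set μ : ℝ × ℝ → E →L[ℝ] ℝ := fun r => dlX I G l (X r) (Y r) with hμd
  set ν : ℝ × ℝ → E →L[ℝ] ℝ := fun r => dlY I G l (X r) (Y r) with hνd
  have hμ : ContDiff ℝ ∞ μ := contDiff_dlX hl (contDiff_fieldX hg) (contDiff_fieldY hg)
  have hν : ContDiff ℝ ∞ ν := contDiff_dlY hl (contDiff_fieldX hg) (contDiff_fieldY hg)
  have htarget : ∀ {r}, g r ∈ φ.source → q r ∈ (φ.extend I).target := fun hr =>
    (φ.extend I).map_source (by rwa [φ.extend_source])
  have hev := eventually_mem_source (hg p) hp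
  have hfield : ∀ᶠ r in 𝓝 p, A (q r) (dT q r) = X r ∧ A (q r) (dS q r) = Y r := by
    filter_upwards [mcForm_eventuallyEq_chart hφ (hg p) hp,
      eventually_differentiableAt_extend_comp hφ (hg p) hp] with r hr hd
    rw [dT_eq_fderiv hd, dS_eq_fderiv hd]
    have hgr := hg.mdifferentiable (by simp) r
    exact ⟨((fieldX_eq_mcForm hgr).trans (by rw [hr]; rfl)).symm,
      ((fieldY_eq_mcForm hgr).trans (by rw [hr]; rfl)).symm⟩
  obtain ⟨hXp, hYp⟩ := hfield.self_of_nhds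
  have dl1 : ∀ x y : E, DifferentiableAt ℝ (fun x => l x y) x := fun x y =>
    (hl.comp (contDiff_prodMk_left y)).differentiable (by simp) x
  have dl2 : ∀ x y : E, DifferentiableAt ℝ (fun y => l x y) y := fun x y =>
    (hl.comp (contDiff_prodMk_right x)).differentiable (by simp) y
  have hmomT : (fun r => fderiv ℝ (fun u => coordLagrangian I L φ (q r) u (dS q r)) (dT q r))
      =ᶠ[𝓝 p] fun r => (μ r).comp (A (q r)) := by
    filter_upwards [hev, hfield] with r hr ⟨h1, h2⟩
    simp only [coordLagrangian_eq_reduced hinv hφ (htarget hr)]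
    have h3 := fderiv_comp (dT q r) (dl1 (A (q r) (dT q r)) (A (q r) (dS q r)))
      (A (q r)).differentiableAt
    rw [ContinuousLinearMap.fderiv, h1, h2] at h3
    refine Eq.trans ?_ h3
    rw [← h2]; rfl
  have hmomS : (fun r => fderiv ℝ (fun v => coordLagrangian I L φ (q r) (dT q r) v) (dS q r))
      =ᶠ[𝓝 p] fun r => (ν r).comp (A (q r)) := by
    filter_upwards [hev, hfield] with r hr ⟨h1, h2⟩
    simp only [coordLagrangian_eq_reduced hinv hφ (htarget hr)]
    have h3 := fderiv_comp (dS q r) (dl2 (A (q r) (dT q r)) (A (q r) (dS q r)))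
      (A (q r)).differentiableAt
    rw [ContinuousLinearMap.fderiv, h1, h2] at h3
    refine Eq.trans ?_ h3
    rw [← h1]; rfl
  have dA : DifferentiableAt ℝ A (q p) :=
    (contDiffAt_mcForm (contMDiffAt_chart_symm hφ (htarget hp))).differentiableAt (by simp)
  have dq : DifferentiableAt ℝ q p :=
    (eventually_differentiableAt_extend_comp hφ (hg p) hp).self_of_nhds
  have hpos : fderiv ℝ (fun x => coordLagrangian I L φ x (dT q p) (dS q p)) (q p) w =
      μ p (fderiv ℝ A (q p) w (dT q p)) + ν p (fderiv ℝ A (q p) w (dS q p)) := by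
    have h1 : (fun x => coordLagrangian I L φ x (dT q p) (dS q p)) =ᶠ[𝓝 (q p)]
        fun x => l (A x (dT q p)) (A x (dS q p)) := by
      filter_upwards [φ.isOpen_extend_target.mem_nhds (htarget hp)] with x hx
      exact coordLagrangian_eq_reduced hinv hφ hx _ _
    have d1 := dA.hasFDerivAt.clm_apply (hasFDerivAt_const (dT q p) (q p))
    have d2 := dA.hasFDerivAt.clm_apply (hasFDerivAt_const (dS q p) (q p))
    have h2 : HasFDerivAt (fun x => l (A x (dT q p)) (A x (dS q p))) _ (q p) :=
      HasFDerivAt.comp (g := fun z : E × E => l z.1 z.2) (q p)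
        (hl.differentiable (by simp) _).hasFDerivAt (d1.prodMk d2)
    rw [h1.fderiv_eq, h2.fderiv]
    simp [fderiv_eq_dlX_add_dlY (I := I) (G := G) hl, hXp, hYp, hμd, hνd]
  have hqT := hasDerivAt_fst_line dq
  have hqS := hasDerivAt_snd_line dq
  rw [← dT_eq_fderiv dq] at hqT
  rw [← dS_eq_fderiv dq] at hqS
  have hT : dT (fun r => (μ r).comp (A (q r))) p w =
      dT μ p (A (q p) w) + μ p (fderiv ℝ A (q p) (dT q p) w) := by
    have h1 := hasDerivAt_fst_line (hμ.differentiable (by simp) p)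
    rw [← dT_eq_fderiv (hμ.differentiable (by simp) p)] at h1
    have h2 := HasFDerivAt.comp_hasDerivAt (l := A) p.1 dA.hasFDerivAt hqT
    have h3 : dT (fun r => (μ r).comp (A (q r))) p = _ := (h1.clm_comp h2).deriv
    rw [h3]
    simp
  have hS : dS (fun r => (ν r).comp (A (q r))) p w =
      dS ν p (A (q p) w) + ν p (fderiv ℝ A (q p) (dS q p) w) := by
    have h1 := hasDerivAt_snd_line (hν.differentiable (by simp) p)
    rw [← dS_eq_fderiv (hν.differentiable (by simp) p)] at h1
    have h2 := HasFDerivAt.comp_hasDerivAt (l := A) p.2 dA.hasFDerivAt hqS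
    have h3 : dS (fun r => (ν r).comp (A (q r))) p = _ := (h1.clm_comp h2).deriv
    rw [h3]
    simp
  have sT := congrArg (μ p) (mcForm_chart_structure hφ (htarget hp) (dT q p) w)
  have sS := congrArg (ν p) (mcForm_chart_structure hφ (htarget hp) (dS q p) w)
  change μ p (fderiv ℝ A (q p) w (dT q p) - fderiv ℝ A (q p) (dT q p) w) =
    μ p (ad I G (A (q p) (dT q p)) (A (q p) w)) at sT
  change ν p (fderiv ℝ A (q p) w (dS q p) - fderiv ℝ A (q p) (dS q p) w) =
    ν p (ad I G (A (q p) (dS q p)) (A (q p) w)) at sS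
  rw [map_sub, hXp] at sT
  rw [map_sub, hYp] at sS
  rw [eulerLagrangeExpr, dT_congr hmomT, dS_congr hmomS, sub_apply, sub_apply, hpos, hT, hS]
  have hEP : eulerPoincareExpr I G l X Y p (A (q p) w) =
      dT μ p (A (q p) w) - μ p (ad I G (X p) (A (q p) w))
        + dS ν p (A (q p) w) - ν p (ad I G (Y p) (A (q p) w)) := rfl
  rw [hEP, ← sT, ← sS]
  ring

theorem eulerLagrange_iff_eulerPoincare (hL : SmoothLagrangian I L) (hinv : LeftInvariant I L)
    {g : ℝ × ℝ → G} (hg : ContMDiff 𝓘(ℝ, ℝ × ℝ) I ∞ g) {t₁ t₂ s₁ s₂ : ℝ} :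
    EulerLagrange I L t₁ t₂ s₁ s₂ g ↔
      EulerPoincare I G (reduced I L) t₁ t₂ s₁ s₂ (fieldX I g) (fieldY I g) := by
  constructor
  · intro h p hp
    have hs : g p ∈ (chartAt H (g p)).source := mem_chart_source H (g p)
    have hφ : chartAt H (g p) ∈ IsManifold.maximalAtlas I ∞ G :=
      IsManifold.chart_mem_maximalAtlas _
    have h0 := h _ hφ p hp hs
    change eulerPoincareExpr I G (reduced I L) (fieldX I g) (fieldY I g) p = 0
    have hinvt := mcForm_chart_symm_isInvertible hφ
      (((chartAt H (g p)).extend I).map_source (by rwa [OpenPartialHomeomorph.extend_source]))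
    ext e
    have h1 := eulerLagrangeExpr_apply hL hinv hg hφ hs
      ((mcForm I ((chartAt H (g p)).extend I).symm
        ((chartAt H (g p)).extend I (g p))).inverse e)
    rw [h0, hinvt.self_apply_inverse] at h1
    exact neg_eq_zero.1 h1.symm
  · intro h φ hφ p hp hs
    ext w
    have h0 : eulerPoincareExpr I G (reduced I L) (fieldX I g) (fieldY I g) p = 0 := h p hp
    rw [eulerLagrangeExpr_apply hL hinv hg hφ hs, h0]
    exact neg_zero

end EulerLagrangeEquations

end GStrand

end

theorem theorem1
    {E : Type*} [NormedAddCommGroup E] [NormedSpace ℝ E] [FiniteDimensional ℝ E]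
    {H : Type*} [TopologicalSpace H] (I : ModelWithCorners ℝ E H) [I.Boundaryless]
    {G : Type*} [TopologicalSpace G] [ChartedSpace H G] [Group G] [LieGroup I ∞ G]
    (L : (x : G) → TangentSpace I x → TangentSpace I x → ℝ)
    (hL : GStrand.SmoothLagrangian I L) (hinv : GStrand.LeftInvariant I L)
    (t₁ t₂ s₁ s₂ : ℝ) (ht : t₁ < t₂) (hs : s₁ < s₂)
    (g : ℝ × ℝ → G) (hg : ContMDiff 𝓘(ℝ, ℝ × ℝ) I ∞ g) :
    List.TFAE [
      GStrand.HamiltonPrinciple I L t₁ t₂ s₁ s₂ g,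
      GStrand.EulerLagrange I L t₁ t₂ s₁ s₂ g,
      GStrand.ConstrainedPrinciple I G (GStrand.reduced I L) t₁ t₂ s₁ s₂
        (GStrand.fieldX I g) (GStrand.fieldY I g),
      GStrand.EulerPoincare I G (GStrand.reduced I L) t₁ t₂ s₁ s₂
        (GStrand.fieldX I g) (GStrand.fieldY I g)] := by
  have hl := GStrand.contDiff_reduced hL
  have hX := GStrand.contDiff_fieldX hg
  have hY := GStrand.contDiff_fieldY hg
  have h1 := GStrand.hamiltonPrinciple_iff_firstVariation (t₁ := t₁) (t₂ := t₂) (s₁ := s₁)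
    (s₂ := s₂) hL hinv hg
  have h2 := GStrand.eulerLagrange_iff_eulerPoincare (t₁ := t₁) (t₂ := t₂) (s₁ := s₁)
    (s₂ := s₂) hL hinv hg
  have h3 := GStrand.constrainedPrinciple_iff_firstVariation (I := I) (G := G) (t₁ := t₁)
    (t₂ := t₂) (s₁ := s₁) (s₂ := s₂) hl hX hY
  have h4 := GStrand.eulerPoincare_iff_firstVariation (I := I) (G := G) ht hs hl hX hY
  tfae_have 1 ↔ 4 := h1.trans h4.symm
  tfae_have 2 ↔ 4 := h2
  tfae_have 3 ↔ 4 := h3.trans h4.symm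
  tfae_finish
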